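/- Let $\alpha\in\mathbb R$, $\alpha\neq-1$, and let $X_\alpha(t)$, $t\in[0,1]$, be a (jointly measurable) zero-mean Gaussian process whose covariance function $G(t,s)=\mathbb E X_\alpha(t)X_\alpha(s)$ is the Green function of the boundary value problem $$-u''=\lambda u\ \text{ on }[0,1],\qquad u(0)+\alpha u(1)=0,\qquad \alpha u'(0)+u'(1)=0,$$ that is, $G$ is continuous on $[0,1]^2$ and, for every $s\in(0,1)$, $G(\cdot,s)$ satisfies $-\partial_t^2G(t,s)=\delta(t-s)$ and the two boundary conditions. Then almost every sample path of $X_\alpha$ lies in $L_2(0,1)$. Let $\overline{X_\alpha}(t)=X_\alpha(t)-\int_0^1X_\alpha(s)\,ds$ be the demeaned process and $\|\cdot\|$ the norm of $L_2(0,1)$. 1. $\overline{X_\alpha}$ is a zero-mean Gaussian process, and for every $\alpha\ne-1$ its covariance function is the generalized Green function of the Neumann problem $$-u''=\lambda u\ \text{ on }[0,1],\qquad u'(0)=u'(1)=0.$$ Here the generalized Green function of a boundary value problem for $-u''$ whose zero eigenspace has the $L_2(0,1)$-orthonormal basis $\varphi_1,\dots,\varphi_m$ is the continuous kernel $K$ on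 $[0,1]^2$ such that $-\partial_t^2K(t,s)=\delta(t-s)-\sum_i\varphi_i(t)\varphi_i(s)$ and $K(\cdot,s)$ satisfies the boundary conditions for every $s\in(0,1)$, and $\int_0^1K(t,s)\varphi_i(t)\,dt=0$ for all $s\in[0,1]$ and all $i$. 2. If $W$ is a standard Wiener process and $\overline W(t)=W(t)-\int_0^1W(s)\,ds$ for $t\in[0,1]$, then $\|\overline{X_\alpha}\|$ and $\|\overline W\|$ have the same distribution; in particular $\mathbb P\{\|\overline{X_\alpha}\|\le\varepsilon\}=\mathbb P\{\|\overline W\|\le\varepsilon\}$ for every $\varepsilon$. 3. As $\varepsilon\to0+$, $$\mathbb P\big\{\|\overline{X_\alpha}\|\le\varepsilon\big\}\sim\Big(\frac8\pi\Big)^{1/2}\exp\Big(-\frac18\,\varepsilon^{-2}\Big).$$ -/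

import Mathlib

open MeasureTheory ProbabilityTheory Filter Topology Set

open scoped Asymptotics

noncomputable section

/-- A linear boundary form `a₀ u(0) + a₁ u(1) + b₀ u'(0) + b₁ u'(1)` on `[0,1]`. -/
structure BoundaryForm where
  a₀ : ℝ
  a₁ : ℝ
  b₀ : ℝ
  b₁ : ℝ

/-- Value of the form when `u(0), u(1), u'(0), u'(1)` are the four given numbers. -/
def BoundaryForm.eval (U : BoundaryForm) (u₀ u₁ du₀ du₁ : ℝ) : ℝ :=
  U.a₀ * u₀ + U.a₁ * u₁ + U.b₀ * du₀ + U.b₁ * du₁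

/-- The conditions `u(0) + α u(1) = 0`, `α u'(0) + u'(1) = 0`. -/
def twistedConditions (α : ℝ) : Fin 2 → BoundaryForm :=
  ![⟨1, α, 0, 0⟩, ⟨0, 0, α, 1⟩]

/-- The Neumann conditions `u'(0) = 0`, `u'(1) = 0`. -/
def neumannConditions : Fin 2 → BoundaryForm :=
  ![⟨0, 0, 1, 0⟩, ⟨0, 0, 0, 1⟩]

/-- `u` is a classical solution on `[0,1]` of `-u'' = 0` with the boundary conditions `U`. -/
structure IsNullSolution (U : Fin 2 → BoundaryForm) (u : ℝ → ℝ) : Prop where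
  contDiffOn : ContDiffOn ℝ 2 u (Icc 0 1)
  equation : ∀ t ∈ Icc (0 : ℝ) 1, -iteratedDerivWithin 2 u (Icc 0 1) t = 0
  boundary : ∀ ν, (U ν).eval (u 0) (u 1)
    (derivWithin u (Icc 0 1) 0) (derivWithin u (Icc 0 1) 1) = 0

/-- The kernel `G` on `[0,1]²` satisfies `-∂²G/∂t² (t,s) = δ(t - s) - r(t,s)` and, as a function
of `t`, the boundary conditions `U`, in the classical sense: `G` is continuous; for `0 < s < 1` the
function `G(·,s)` is `C²` up to the endpoints on each of `[0,s]` and `[s,1]`, where it solves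
`-u'' = -r(·,s)`; its derivative jumps by `-1` at `t = s`; and `G(·,s)` satisfies the boundary
conditions. -/
structure IsPointSourceKernel (U : Fin 2 → BoundaryForm) (r G : ℝ → ℝ → ℝ) : Prop where
  continuousOn : ContinuousOn (Function.uncurry G) (Icc 0 1 ×ˢ Icc 0 1)
  contDiffOn_left : ∀ s ∈ Ioo (0 : ℝ) 1, ContDiffOn ℝ 2 (fun t => G t s) (Icc 0 s)
  contDiffOn_right : ∀ s ∈ Ioo (0 : ℝ) 1, ContDiffOn ℝ 2 (fun t => G t s) (Icc s 1)
  equation_left : ∀ s ∈ Ioo (0 : ℝ) 1, ∀ t ∈ Icc 0 s,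
    -iteratedDerivWithin 2 (fun t => G t s) (Icc 0 s) t = -r t s
  equation_right : ∀ s ∈ Ioo (0 : ℝ) 1, ∀ t ∈ Icc s 1,
    -iteratedDerivWithin 2 (fun t => G t s) (Icc s 1) t = -r t s
  jump : ∀ s ∈ Ioo (0 : ℝ) 1,
    derivWithin (fun t => G t s) (Icc s 1) s - derivWithin (fun t => G t s) (Icc 0 s) s = -1
  boundary : ∀ s ∈ Ioo (0 : ℝ) 1, ∀ ν, (U ν).eval (G 0 s) (G 1 s)
    (derivWithin (fun t => G t s) (Icc 0 s) 0) (derivWithin (fun t => G t s) (Icc s 1) 1) = 0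

/-- `G` is the Green function of `-u''` on `[0,1]` with the boundary conditions `U`. -/
def IsGreenFunction (U : Fin 2 → BoundaryForm) (G : ℝ → ℝ → ℝ) : Prop :=
  IsPointSourceKernel U (fun _ _ => 0) G

/-- `φ` is an `L²(0,1)`-orthonormal basis of the space of solutions of `-u'' = 0` with the boundary
conditions `U`, that is, of the eigenspace for the eigenvalue zero. -/
structure IsNullBasis (U : Fin 2 → BoundaryForm) {m : ℕ} (φ : Fin m → ℝ → ℝ) : Prop where
  null : ∀ i, IsNullSolution U (φ i)
  orthonormal : ∀ i j, ∫ t in (0 : ℝ)..1, φ i t * φ j t = if i = j then 1 else 0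
  spans : ∀ u, IsNullSolution U u → ∃ c : Fin m → ℝ, ∀ t ∈ Icc (0 : ℝ) 1, u t = ∑ i, c i * φ i t

/-- `G` is the generalized Green function of `-u''` on `[0,1]` with the boundary conditions `U`:
`-∂²G/∂t² (t,s) = δ(t - s) - ∑ φ_i(t) φ_i(s)` with the conditions `U`, and `G(·,s)` is orthogonal
to every `φ_i`, where the `φ_i` are an orthonormal basis of the zero eigenspace. -/
def IsGeneralizedGreenFunction (U : Fin 2 → BoundaryForm) (G : ℝ → ℝ → ℝ) : Prop :=
  ∃ (m : ℕ) (φ : Fin m → ℝ → ℝ), IsNullBasis U φ ∧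
    IsPointSourceKernel U (fun t s => ∑ i, φ i t * φ i s) G ∧
    ∀ s ∈ Icc (0 : ℝ) 1, ∀ i, ∫ t in (0 : ℝ)..1, G t s * φ i t = 0

variable {Ω : Type*} [MeasurableSpace Ω]

/-- `X` is a zero-mean Gaussian process on `[0,1]`, measurable as a function of time and chance
jointly (up to null sets). Values `X t` with `t ∉ [0,1]` play no role. -/
structure IsCenteredGaussianOnUnit (X : ℝ → Ω → ℝ) (P : Measure Ω) : Prop where
  gaussian : IsGaussianProcess (fun t : Icc (0 : ℝ) 1 => X t) P
  mean_zero : ∀ t ∈ Icc (0 : ℝ) 1, ∫ ω, X t ω ∂P = 0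
  aemeasurable : AEMeasurable (Function.uncurry X) ((volume.restrict (Icc (0 : ℝ) 1)).prod P)

/-- `G_X(t,s) = E X(t) X(s)`. -/
def covKernel (X : ℝ → Ω → ℝ) (P : Measure Ω) (t s : ℝ) : ℝ :=
  ∫ ω, X t ω * X s ω ∂P

/-- The demeaned process `X(t) - ∫₀¹ X(s) ds`. -/
def demean (X : ℝ → Ω → ℝ) (t : ℝ) (ω : Ω) : ℝ :=
  X t ω - ∫ s in (0 : ℝ)..1, X s ω

/-- The `L²(0,1)` norm of the sample path. -/
def pathNorm (X : ℝ → Ω → ℝ) (ω : Ω) : ℝ :=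
  √(∫ t in (0 : ℝ)..1, X t ω ^ 2)

/-- Restriction of a process with time set `[0,∞)` to times in `[0,1]`. -/
def onUnit (W : NNReal → Ω → ℝ) (t : ℝ) (ω : Ω) : ℝ :=
  W t.toNNReal ω

end

/-!
Subtracting the mean centres the covariance in both variables, which annihilates every summand
depending on one variable only. The covariance `G` of `X` and the Wiener covariance `min t s`
differ by such summands, so for every `α` both demeaned processes have the covariance
`neumannKernel`.

Expanding paths in the Neumann cosines gives independent Gaussian coefficients of variance
`1 / (π n)²`, and Euler's product for `sinh` then yields `E exp(-θ² ‖Y‖² / 2) = √(θ / sinh θ)` for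
the demeaned process `Y`. The right-hand side is
`√(2θ) exp(-θ / 2) (1 - exp(-2θ)) ^ (-1 / 2)`. Expanding the last factor in a binomial series and
inverting the Laplace transform term by term gives a series for the distribution function of
`‖Y‖²` whose first term carries the small ball asymptotics.
-/

section GreenFunctions

lemma affine_of_iteratedDerivWithin_two_eq_zero {u : ℝ → ℝ} {a b : ℝ} (hab : a < b)
    (hu : ContDiffOn ℝ 2 u (Icc a b))
    (h0 : ∀ t ∈ Icc a b, iteratedDerivWithin 2 u (Icc a b) t = 0) :
    ∃ p, ∀ t ∈ Icc a b, derivWithin u (Icc a b) t = p ∧ u t = u a + p * (t - a) := by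
  have hU := uniqueDiffOn_Icc hab
  have hdu : DifferentiableOn ℝ (derivWithin u (Icc a b)) (Icc a b) :=
    (hu.derivWithin hU (m := 1) (by norm_num)).differentiableOn (by norm_num)
  set p := derivWithin u (Icc a b) a
  have hslope : ∀ t ∈ Icc a b, derivWithin u (Icc a b) t = p :=
    constant_of_derivWithin_zero hdu fun t ht => by
      have := h0 t (Ico_subset_Icc_self ht)
      rwa [iteratedDerivWithin_succ, iteratedDerivWithin_one] at this
  have hdiff : ∀ t ∈ Icc a b,
      HasDerivWithinAt (fun t => u t - p * (t - a)) (p - p) (Icc a b) t := by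
    intro t ht
    have hline : HasDerivWithinAt (fun t => p * (t - a)) p (Icc a b) t := by
      simpa using (((hasDerivAt_id t).sub_const a).const_mul p).hasDerivWithinAt
    refine HasDerivWithinAt.sub ?_ hline
    rw [← hslope t ht]
    exact (hu.differentiableOn (by norm_num) t ht).hasDerivWithinAt
  have hconst := constant_of_derivWithin_zero
    (fun t ht => (hdiff t ht).differentiableWithinAt) fun t ht => by
      rw [(hdiff t (Ico_subset_Icc_self ht)).derivWithin (hU t (Ico_subset_Icc_self ht)), sub_self]
  refine ⟨p, fun t ht => ⟨hslope t ht, ?_⟩⟩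
  linear_combination hconst t ht

lemma IsPointSourceKernel.congr {U : Fin 2 → BoundaryForm} {r G G' : ℝ → ℝ → ℝ}
    (hG : IsPointSourceKernel U r G)
    (h : ∀ t ∈ Icc (0 : ℝ) 1, ∀ s ∈ Icc (0 : ℝ) 1, G' t s = G t s) :
    IsPointSourceKernel U r G' := by
  have hl : ∀ s ∈ Ioo (0 : ℝ) 1, EqOn (fun t => G' t s) (fun t => G t s) (Icc 0 s) :=
    fun s hs t ht => h t ⟨ht.1, ht.2.trans hs.2.le⟩ s ⟨hs.1.le, hs.2.le⟩
  have hr : ∀ s ∈ Ioo (0 : ℝ) 1, EqOn (fun t => G' t s) (fun t => G t s) (Icc s 1) :=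
    fun s hs t ht => h t ⟨hs.1.le.trans ht.1, ht.2⟩ s ⟨hs.1.le, hs.2.le⟩
  refine ⟨?_, ?_, ?_, ?_, ?_, ?_, ?_⟩
  · exact hG.continuousOn.congr (fun x hx => h x.1 hx.1 x.2 hx.2)
  · exact fun s hs => (hG.contDiffOn_left s hs).congr (hl s hs)
  · exact fun s hs => (hG.contDiffOn_right s hs).congr (hr s hs)
  · intro s hs t ht
    rw [iteratedDerivWithin_congr (hl s hs) ht]
    exact hG.equation_left s hs t ht
  · intro s hs t ht
    rw [iteratedDerivWithin_congr (hr s hs) ht]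
    exact hG.equation_right s hs t ht
  · intro s hs
    rw [derivWithin_congr (hl s hs) (hl s hs ⟨hs.1.le, le_rfl⟩),
      derivWithin_congr (hr s hs) (hr s hs ⟨le_rfl, hs.2.le⟩)]
    exact hG.jump s hs
  · intro s hs ν
    rw [derivWithin_congr (hl s hs) (hl s hs ⟨le_rfl, hs.1.le⟩),
      derivWithin_congr (hr s hs) (hr s hs ⟨hs.2.le, le_rfl⟩),
      h 0 ⟨le_rfl, by norm_num⟩ s ⟨hs.1.le, hs.2.le⟩,
      h 1 ⟨by norm_num, le_rfl⟩ s ⟨hs.1.le, hs.2.le⟩]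
    exact hG.boundary s hs ν

lemma IsGreenFunction.exists_eq_min_add_affine {U : Fin 2 → BoundaryForm} {G : ℝ → ℝ → ℝ}
    (hG : IsGreenFunction U G) {s : ℝ} (hs : s ∈ Ioo (0 : ℝ) 1) :
    ∃ p, derivWithin (fun t => G t s) (Icc 0 s) 0 = p ∧
      derivWithin (fun t => G t s) (Icc s 1) 1 = p - 1 ∧
      ∀ t ∈ Icc (0 : ℝ) 1, G t s = G 0 s + (p - 1) * t + min t s := by
  obtain ⟨p, hp⟩ := affine_of_iteratedDerivWithin_two_eq_zero hs.1 (hG.contDiffOn_left s hs)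
    (fun t ht => by simpa using hG.equation_left s hs t ht)
  obtain ⟨q, hq⟩ := affine_of_iteratedDerivWithin_two_eq_zero hs.2 (hG.contDiffOn_right s hs)
    (fun t ht => by simpa using hG.equation_right s hs t ht)
  have hp_s := hp s ⟨hs.1.le, le_rfl⟩
  have hjump : q - p = -1 := by
    rw [← (hq s ⟨le_rfl, hs.2.le⟩).1, ← hp_s.1]
    exact hG.jump s hs
  refine ⟨p, (hp 0 ⟨le_rfl, hs.1.le⟩).1, ?_, fun t ht => ?_⟩
  · rw [(hq 1 ⟨hs.2.le, le_rfl⟩).1]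
    linarith
  · rcases le_total t s with hts | hst
    · rw [min_eq_left hts, (hp t ⟨ht.1, hts⟩).2]
      ring
    · rw [min_eq_right hst, (hq t ⟨hst, ht.2⟩).2, hp_s.2]
      linear_combination (t - s) * hjump

/-- The closed form of the Green function of the twisted problem with parameter `α ≠ -1`. -/
noncomputable def twistedKernel (α t s : ℝ) : ℝ :=
  min t s - α / (1 + α) * (t + s) + (α / (1 + α)) ^ 2

lemma IsGreenFunction.eq_twistedKernel_of_mem_Ioo {α : ℝ} (hα : α ≠ -1) {G : ℝ → ℝ → ℝ}
    (hG : IsGreenFunction (twistedConditions α) G) {t s : ℝ} (ht : t ∈ Icc (0 : ℝ) 1)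
    (hs : s ∈ Ioo (0 : ℝ) 1) : G t s = twistedKernel α t s := by
  have hα' : 1 + α ≠ 0 := fun h => hα (by linarith)
  obtain ⟨p, hleft, hright, hGt⟩ := hG.exists_eq_min_add_affine hs
  have hvalues := hG.boundary s hs 0
  have hslopes := hG.boundary s hs 1
  have hG1 := hGt 1 ⟨zero_le_one, le_rfl⟩
  rw [min_eq_right hs.2.le] at hG1
  simp only [twistedConditions, BoundaryForm.eval, Matrix.cons_val_zero, Matrix.cons_val_one,
    hleft, hright, hG1] at hvalues hslopes
  have hp : p = 1 / (1 + α) := by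
    field_simp
    linear_combination hslopes
  have hG0 : G 0 s = α / (1 + α) * (α / (1 + α) - s) := by
    rw [hp] at hvalues
    field_simp at hvalues ⊢
    linear_combination hvalues
  rw [hGt t ht, hG0, hp, twistedKernel]
  field_simp
  ring

lemma IsGreenFunction.eq_twistedKernel {α : ℝ} (hα : α ≠ -1) {G : ℝ → ℝ → ℝ}
    (hG : IsGreenFunction (twistedConditions α) G) {t s : ℝ} (ht : t ∈ Icc (0 : ℝ) 1)
    (hs : s ∈ Icc (0 : ℝ) 1) : G t s = twistedKernel α t s := by
  have hcont : ContinuousOn (fun s => G t s) (Icc 0 1) :=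
    hG.continuousOn.comp (f := fun s => (t, s)) (by fun_prop) (fun s hs => ⟨ht, hs⟩)
  have hinterior : EqOn (fun s => G t s) (fun s => twistedKernel α t s) (Ioo 0 1) :=
    fun s hs => hG.eq_twistedKernel_of_mem_Ioo hα ht hs
  exact hinterior.of_subset_closure hcont (by unfold twistedKernel; fun_prop)
    Ioo_subset_Icc_self (by rw [closure_Ioo zero_ne_one]) hs

end GreenFunctions

section NeumannKernel

/-- The closed form of the generalized Green function of the Neumann problem. -/
noncomputable def neumannKernel (t s : ℝ) : ℝ :=
  min t s - (t - t ^ 2 / 2) - (s - s ^ 2 / 2) + 1 / 3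

lemma continuous_neumannKernel : Continuous (Function.uncurry neumannKernel) := by
  unfold neumannKernel Function.uncurry; fun_prop

lemma intervalIntegral_eq_add_of_eqOn {f g h : ℝ → ℝ} {a b c : ℝ} (hb : b ∈ Icc a c)
    (hg : Continuous g) (hh : Continuous h) (hfg : EqOn f g (Icc a b))
    (hfh : EqOn f h (Icc b c)) :
    ∫ r in a..c, f r = (∫ r in a..b, g r) + ∫ r in b..c, h r := by
  rw [← uIcc_of_le hb.1] at hfg
  rw [← uIcc_of_le hb.2] at hfh
  rw [← intervalIntegral.integral_congr hfg, ← intervalIntegral.integral_congr hfh,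
    intervalIntegral.integral_add_adjacent_intervals]
  · exact (intervalIntegrable_congr_uIoo (hfg.mono uIoo_subset_uIcc_self)).2
      (hg.intervalIntegrable a b)
  · exact (intervalIntegrable_congr_uIoo (hfh.mono uIoo_subset_uIcc_self)).2
      (hh.intervalIntegrable b c)

lemma integral_min {s : ℝ} (hs : s ∈ Icc (0 : ℝ) 1) :
    ∫ r in (0 : ℝ)..1, min s r = s - s ^ 2 / 2 := by
  rw [intervalIntegral_eq_add_of_eqOn hs (g := fun r => r) (h := fun _ => s) (by fun_prop)
    (by fun_prop) (fun r hr => min_eq_right hr.2) (fun r hr => min_eq_left hr.1)]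
  simp only [integral_id, intervalIntegral.integral_const, smul_eq_mul]
  ring

lemma integral_neumannKernel {s : ℝ} (hs : s ∈ Icc (0 : ℝ) 1) :
    ∫ t in (0 : ℝ)..1, neumannKernel t s = 0 := by
  have hsplit : ∀ t, neumannKernel t s =
      min s t - (t - t ^ 2 / 2) + (1 / 3 - (s - s ^ 2 / 2)) := by
    intro t; unfold neumannKernel; rw [min_comm]; ring
  simp_rw [hsplit]
  rw [intervalIntegral.integral_add, intervalIntegral.integral_sub, integral_min hs,
    intervalIntegral.integral_sub, intervalIntegral.integral_div, integral_id, integral_pow,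
    intervalIntegral.integral_const]
  · simp only [smul_eq_mul]
    norm_num
  all_goals exact Continuous.intervalIntegrable (by fun_prop) _ _

lemma integral_neumannKernel_diag : ∫ t in (0 : ℝ)..1, neumannKernel t t = 1 / 6 := by
  have hdiag : ∀ t, neumannKernel t t = t ^ 2 - t + 1 / 3 := by
    intro t; unfold neumannKernel; rw [min_self]; ring
  simp_rw [hdiag]
  rw [intervalIntegral.integral_add, intervalIntegral.integral_sub, integral_id, integral_pow,
    intervalIntegral.integral_const]
  · norm_num
  all_goals exact Continuous.intervalIntegrable (by fun_prop) _ _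

lemma hasDerivAt_half_sq_add (a b t : ℝ) :
    HasDerivAt (fun t : ℝ => t ^ 2 / 2 + a * t + b) (t + a) t := by
  have hsq := ((hasDerivAt_id t).pow 2).div_const 2
  exact ((hsq.add ((hasDerivAt_id t).const_mul a)).add_const b).congr_deriv (by simp)

lemma derivWithin_of_eqOn_half_sq_add {f : ℝ → ℝ} {a b x y t : ℝ} (hxy : x < y)
    (h : EqOn f (fun t => t ^ 2 / 2 + a * t + b) (Icc x y)) (ht : t ∈ Icc x y) :
    derivWithin f (Icc x y) t = t + a := by
  rw [derivWithin_congr h (h ht)]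
  exact (hasDerivAt_half_sq_add a b t).hasDerivWithinAt.derivWithin (uniqueDiffOn_Icc hxy t ht)

lemma iteratedDerivWithin_two_of_eqOn_half_sq_add {f : ℝ → ℝ} {a b x y t : ℝ} (hxy : x < y)
    (h : EqOn f (fun t => t ^ 2 / 2 + a * t + b) (Icc x y)) (ht : t ∈ Icc x y) :
    iteratedDerivWithin 2 f (Icc x y) t = 1 := by
  have hderiv : EqOn (derivWithin f (Icc x y)) (fun t => t + a) (Icc x y) :=
    fun t ht => derivWithin_of_eqOn_half_sq_add hxy h ht
  rw [iteratedDerivWithin_succ, iteratedDerivWithin_one, derivWithin_congr hderiv (hderiv ht)]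
  exact ((hasDerivAt_id t).add_const a).hasDerivWithinAt.derivWithin (uniqueDiffOn_Icc hxy t ht)

lemma isPointSourceKernel_neumannKernel :
    IsPointSourceKernel neumannConditions (fun _ _ => 1) neumannKernel := by
  have hl : ∀ s, EqOn (fun t => neumannKernel t s)
      (fun t => t ^ 2 / 2 + 0 * t + (1 / 3 - (s - s ^ 2 / 2))) (Icc 0 s) := by
    intro s t ht
    simp only [neumannKernel, min_eq_left ht.2]; ring
  have hr : ∀ s, EqOn (fun t => neumannKernel t s)
      (fun t => t ^ 2 / 2 + (-1) * t + (1 / 3 + s ^ 2 / 2)) (Icc s 1) := by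
    intro s t ht
    simp only [neumannKernel, min_eq_right ht.1]; ring
  refine ⟨continuous_neumannKernel.continuousOn, ?_, ?_, ?_, ?_, ?_, ?_⟩
  · exact fun s _ => ContDiffOn.congr (by fun_prop) (hl s)
  · exact fun s _ => ContDiffOn.congr (by fun_prop) (hr s)
  · exact fun s hs t ht => by
      rw [iteratedDerivWithin_two_of_eqOn_half_sq_add hs.1 (hl s) ht]
  · exact fun s hs t ht => by
      rw [iteratedDerivWithin_two_of_eqOn_half_sq_add hs.2 (hr s) ht]
  · intro s hs
    rw [derivWithin_of_eqOn_half_sq_add hs.1 (hl s) ⟨hs.1.le, le_rfl⟩,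
      derivWithin_of_eqOn_half_sq_add hs.2 (hr s) ⟨le_rfl, hs.2.le⟩]
    ring
  · intro s hs ν
    rw [derivWithin_of_eqOn_half_sq_add hs.1 (hl s) ⟨le_rfl, hs.1.le⟩,
      derivWithin_of_eqOn_half_sq_add hs.2 (hr s) ⟨hs.2.le, le_rfl⟩]
    fin_cases ν <;> simp [neumannConditions, BoundaryForm.eval]

lemma isNullBasis_neumann : IsNullBasis neumannConditions (fun (_ : Fin 1) (_ : ℝ) => (1 : ℝ)) := by
  refine ⟨fun _ => ⟨contDiffOn_const, ?_, ?_⟩, ?_, ?_⟩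
  · intro t _
    simp [iteratedDerivWithin_const]
  · intro ν
    fin_cases ν <;> simp [neumannConditions, BoundaryForm.eval]
  · intro i j
    simp [Subsingleton.elim i j]
  · intro u hu
    obtain ⟨p, hp⟩ := affine_of_iteratedDerivWithin_two_eq_zero zero_lt_one hu.contDiffOn
      (fun t ht => by simpa using hu.equation t ht)
    have hslope := hu.boundary 0
    simp only [neumannConditions, BoundaryForm.eval, Matrix.cons_val_zero,
      (hp 0 ⟨le_rfl, zero_le_one⟩).1] at hslope
    refine ⟨fun _ => u 0, fun t ht => ?_⟩
    rw [(hp t ht).2, Finset.univ_unique, Finset.sum_singleton]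
    linear_combination t * hslope

lemma isGeneralizedGreenFunction_neumann_of_eq {G : ℝ → ℝ → ℝ}
    (h : ∀ t ∈ Icc (0 : ℝ) 1, ∀ s ∈ Icc (0 : ℝ) 1, G t s = neumannKernel t s) :
    IsGeneralizedGreenFunction neumannConditions G := by
  refine ⟨1, fun _ _ => 1, isNullBasis_neumann, ?_, fun s hs _ => ?_⟩
  · simpa using isPointSourceKernel_neumannKernel.congr h
  · refine (intervalIntegral.integral_congr fun t ht => ?_).trans (integral_neumannKernel hs)
    rw [uIcc_of_le zero_le_one] at ht
    simp only [h t ht s hs, mul_one]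

end NeumannKernel

section DoubleCentering

/-- The kernel obtained from `K` by projecting both variables onto the orthogonal complement of the
constants in `L²(0,1)`; if `K` is the covariance of a process, this is the covariance of the
demeaned process. -/
noncomputable def doublyCentered (K : ℝ → ℝ → ℝ) (t s : ℝ) : ℝ :=
  K t s - (∫ r in (0 : ℝ)..1, K t r) - (∫ r in (0 : ℝ)..1, K r s) +
    ∫ x in (0 : ℝ)..1, ∫ y in (0 : ℝ)..1, K x y

lemma doublyCentered_congr {K K' : ℝ → ℝ → ℝ}
    (h : ∀ t ∈ Icc (0 : ℝ) 1, ∀ s ∈ Icc (0 : ℝ) 1, K t s = K' t s) {t s : ℝ}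
    (ht : t ∈ Icc (0 : ℝ) 1) (hs : s ∈ Icc (0 : ℝ) 1) :
    doublyCentered K t s = doublyCentered K' t s := by
  rw [← uIcc_of_le (zero_le_one (α := ℝ))] at h ht hs
  unfold doublyCentered
  rw [h t ht s hs, intervalIntegral.integral_congr (h t ht),
    intervalIntegral.integral_congr (fun r hr => h r hr s hs),
    intervalIntegral.integral_congr (fun x hx => intervalIntegral.integral_congr (h x hx))]

lemma doublyCentered_add_separate {K : ℝ → ℝ → ℝ} {f g : ℝ → ℝ}
    (hK : Continuous (Function.uncurry K)) (hf : Continuous f) (hg : Continuous g) :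
    doublyCentered (fun t s => K t s + (f t + g s)) = doublyCentered K := by
  have hKr : ∀ t, Continuous (fun r => K t r) := fun t => by fun_prop
  have hKl : ∀ s, Continuous (fun r => K r s) := fun s => by fun_prop
  have hrow : ∀ t, ∫ r in (0 : ℝ)..1, (K t r + (f t + g r)) =
      (∫ r in (0 : ℝ)..1, K t r) + (f t + ∫ r in (0 : ℝ)..1, g r) := by
    intro t
    rw [intervalIntegral.integral_add ((hKr t).intervalIntegrable _ _)
      (Continuous.intervalIntegrable (by fun_prop) _ _), intervalIntegral.integral_add
      (Continuous.intervalIntegrable (by fun_prop) _ _) (hg.intervalIntegrable _ _)]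
    simp
  have hcol : ∀ s, ∫ r in (0 : ℝ)..1, (K r s + (f r + g s)) =
      (∫ r in (0 : ℝ)..1, K r s) + ((∫ r in (0 : ℝ)..1, f r) + g s) := by
    intro s
    rw [intervalIntegral.integral_add ((hKl s).intervalIntegrable _ _)
      (Continuous.intervalIntegrable (by fun_prop) _ _), intervalIntegral.integral_add
      (hf.intervalIntegrable _ _) (Continuous.intervalIntegrable (by fun_prop) _ _)]
    simp
  have htotal : ∫ x in (0 : ℝ)..1, ((∫ r in (0 : ℝ)..1, K x r) +
      (f x + ∫ r in (0 : ℝ)..1, g r)) = (∫ x in (0 : ℝ)..1, ∫ r in (0 : ℝ)..1, K x r) +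
      ((∫ x in (0 : ℝ)..1, f x) + ∫ r in (0 : ℝ)..1, g r) := by
    rw [intervalIntegral.integral_add (Continuous.intervalIntegrable
      (intervalIntegral.continuous_parametric_intervalIntegral_of_continuous' hK 0 1) _ _)
      (Continuous.intervalIntegrable (by fun_prop) _ _), intervalIntegral.integral_add
      (hf.intervalIntegrable _ _) (Continuous.intervalIntegrable (by fun_prop) _ _)]
    simp
  funext t s
  unfold doublyCentered
  rw [hcol s]
  simp only [hrow, htotal]
  ring

lemma doublyCentered_min {t s : ℝ} (ht : t ∈ Icc (0 : ℝ) 1) (hs : s ∈ Icc (0 : ℝ) 1) :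
    doublyCentered (fun t s => min t s) t s = neumannKernel t s := by
  have htotal : ∫ x in (0 : ℝ)..1, ∫ y in (0 : ℝ)..1, min x y = 1 / 3 := by
    rw [intervalIntegral.integral_congr (g := fun x => x - x ^ 2 / 2) fun x hx => integral_min
      (by rwa [uIcc_of_le zero_le_one] at hx), intervalIntegral.integral_sub
      (Continuous.intervalIntegrable (by fun_prop) _ _)
      (Continuous.intervalIntegrable (by fun_prop) _ _), intervalIntegral.integral_div,
      integral_id, integral_pow]
    norm_num
  simp only [doublyCentered, neumannKernel, htotal, integral_min ht, min_comm _ s, integral_min hs]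

lemma doublyCentered_twistedKernel (α : ℝ) {t s : ℝ} (ht : t ∈ Icc (0 : ℝ) 1)
    (hs : s ∈ Icc (0 : ℝ) 1) : doublyCentered (twistedKernel α) t s = neumannKernel t s := by
  have hsplit : twistedKernel α = fun t s => min t s +
      ((-(α / (1 + α)) * t + (α / (1 + α)) ^ 2) + -(α / (1 + α)) * s) := by
    funext t s
    rw [twistedKernel]
    ring
  rw [hsplit, doublyCentered_add_separate (by unfold Function.uncurry; fun_prop) (by fun_prop)
    (by fun_prop), doublyCentered_min ht hs]

end DoubleCentering

section GaussianSubspace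

variable {Ω : Type*} [MeasurableSpace Ω] {P : Measure Ω}

lemma inner_toLp_eq_integral {f g : Ω → ℝ} (hf : MemLp f 2 P) (hg : MemLp g 2 P) :
    inner ℝ (hf.toLp f) (hg.toLp g) = ∫ ω, f ω * g ω ∂P := by
  rw [L2.inner_def]
  refine integral_congr_ae ?_
  filter_upwards [hf.coeFn_toLp, hg.coeFn_toLp] with ω hfω hgω
  rw [hfω, hgω, RCLike.inner_apply, conj_trivial, mul_comm]

lemma coeFn_sum_smul_toLp_ae_eq {ι : Type*} (s : Finset ι) (c : ι → ℝ) {Z : ι → Ω → ℝ}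
    (hZ : ∀ i, MemLp (Z i) 2 P) :
    ⇑(∑ i ∈ s, c i • (hZ i).toLp (Z i)) =ᵐ[P] fun ω => ∑ i ∈ s, c i * Z i ω := by
  have hterm : ∀ i ∈ s, ∀ᵐ ω ∂P, (c i • (hZ i).toLp (Z i) : Lp ℝ 2 P) ω = c i * Z i ω := by
    intro i _
    filter_upwards [Lp.coeFn_smul (c i) ((hZ i).toLp (Z i)), (hZ i).coeFn_toLp] with ω hc hω
    rw [hc, Pi.smul_apply, hω, smul_eq_mul]
  filter_upwards [Lp.coeFn_finsetSum s fun i => c i • (hZ i).toLp (Z i),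
    (Finset.eventually_all s).2 hterm] with ω hsum hω
  rw [hsum, Finset.sum_apply, Finset.sum_congr rfl hω]

/-- A subspace of `L²` all of whose elements are centered Gaussian random variables. -/
def IsGaussianSubspace (H : Submodule ℝ (Lp ℝ 2 P)) : Prop :=
  ∀ f ∈ H, P.map f = gaussianReal 0 (‖f‖₊ ^ 2)

lemma Lp_map_eq_gaussianReal_of_hasGaussianLaw {f : Lp ℝ 2 P} (hf : HasGaussianLaw f P)
    (hmean : ∫ ω, f ω ∂P = 0) : P.map f = gaussianReal 0 (‖f‖₊ ^ 2) := by
  rw [hf.map_eq_gaussianReal, hmean, variance_of_integral_eq_zero hf.aemeasurable hmean]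
  congr 1
  ext
  rw [Real.coe_toNNReal _ (integral_nonneg fun ω => sq_nonneg _), NNReal.coe_pow, coe_nnnorm,
    ← real_inner_self_eq_norm_sq, L2.inner_def]
  simp_rw [RCLike.inner_apply, conj_trivial, pow_two]

lemma isClosed_setOf_Lp_map_eq_gaussianReal [IsProbabilityMeasure P] :
    IsClosed {f : Lp ℝ 2 P | P.map f = gaussianReal 0 (‖f‖₊ ^ 2)} := by
  refine isSeqClosed_iff_isClosed.1 fun f g (hf : ∀ n, P.map (f n) = _) hfg => ?_
  have hmeas : ∀ f : Lp ℝ 2 P, AEMeasurable f P := fun f => (Lp.aestronglyMeasurable f).aemeasurable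
  have : ∀ f : Lp ℝ 2 P, IsProbabilityMeasure (P.map f) :=
    fun f => Measure.isProbabilityMeasure_map (hmeas f)
  have hlaw := ((tendstoInMeasure_of_tendsto_Lp hfg).tendstoInDistribution_of_aemeasurable
    (fun n => hmeas (f n)) (hmeas g)).tendsto
  refine Measure.ext_of_charFun (funext fun t => ?_)
  refine tendsto_nhds_unique (ProbabilityMeasure.tendsto_iff_tendsto_charFun.1 hlaw t) ?_
  have hvar : Tendsto (fun n => ((‖f n‖₊ ^ 2 : NNReal) : ℂ)) atTop (𝓝 ((‖g‖₊ ^ 2 : NNReal) : ℂ)) :=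
    ((Complex.continuous_ofReal.comp NNReal.continuous_coe).tendsto _).comp (hfg.nnnorm.pow 2)
  simp only [ProbabilityMeasure.coe_mk, hf, charFun_gaussianReal]
  exact (((hvar.mul_const _).div_const _).const_sub _).cexp

lemma IsGaussianSubspace.topologicalClosure [IsProbabilityMeasure P]
    {H : Submodule ℝ (Lp ℝ 2 P)} (hH : IsGaussianSubspace H) :
    IsGaussianSubspace H.topologicalClosure := fun _ hf =>
  closure_minimal (s := (H : Set (Lp ℝ 2 P))) hH isClosed_setOf_Lp_map_eq_gaussianReal hf

lemma IsGaussianSubspace.integral_eq_zero {H : Submodule ℝ (Lp ℝ 2 P)} (hH : IsGaussianSubspace H)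
    {f : Ω → ℝ} (hf : MemLp f 2 P) (hfH : hf.toLp f ∈ H) : ∫ ω, f ω ∂P = 0 := by
  rw [← integral_congr_ae hf.coeFn_toLp,
    ← integral_map (f := fun x : ℝ => x) (Lp.aestronglyMeasurable _).aemeasurable
      aestronglyMeasurable_id, hH _ hfH, integral_id_gaussianReal]

lemma IsGaussianSubspace.isGaussianProcess {H : Submodule ℝ (Lp ℝ 2 P)}
    (hH : IsGaussianSubspace H) {T : Type*} {Z : T → Ω → ℝ} (hZ : ∀ t, MemLp (Z t) 2 P)
    (hZH : ∀ t, (hZ t).toLp (Z t) ∈ H) : IsGaussianProcess Z P := by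
  classical
  refine ⟨fun I => ⟨isGaussian_of_map_eq_gaussianReal fun L => ?_⟩⟩
  have hmeas : AEMeasurable (fun ω => I.restrict (Z · ω)) P :=
    aemeasurable_pi_lambda _ fun i => (hZ i).aestronglyMeasurable.aemeasurable
  have hL : ∀ ω, L (I.restrict (Z · ω)) = ∑ i : I, L (Pi.single i 1) * Z i ω := by
    intro ω
    conv_lhs => rw [← Finset.univ_sum_single (I.restrict (Z · ω)), map_sum]
    refine Finset.sum_congr rfl fun i _ => ?_
    rw [mul_comm, ← smul_eq_mul, ← map_smul, ← Pi.single_smul, smul_eq_mul, mul_one,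
      Finset.restrict]
  have hsum := coeFn_sum_smul_toLp_ae_eq Finset.univ (fun i : I => L (Pi.single i 1))
    fun i : I => hZ i
  refine ⟨0, ‖∑ i : I, L (Pi.single i 1) • (hZ i).toLp (Z i)‖₊ ^ 2, ?_⟩
  rw [AEMeasurable.map_map_of_aemeasurable (by fun_prop) hmeas,
    ← hH _ (H.sum_mem (t := Finset.univ) fun i _ => H.smul_mem (L (Pi.single i 1)) (hZH i))]
  exact Measure.map_congr (hsum.trans (ae_of_all _ fun ω => (hL ω).symm)).symm

lemma isGaussianSubspace_span_of_isGaussianProcess {T : Type*} {Z : T → Ω → ℝ}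
    (h : IsGaussianProcess Z P) (hZ : ∀ t, MemLp (Z t) 2 P) (h0 : ∀ t, ∫ ω, Z t ω ∂P = 0) :
    IsGaussianSubspace (Submodule.span ℝ (range fun t => (hZ t).toLp (Z t))) := by
  have := h.isProbabilityMeasure
  intro f hf
  obtain ⟨c, rfl⟩ := Finsupp.mem_span_range_iff_exists_finsupp.1 hf
  have hsum := coeFn_sum_smul_toLp_ae_eq c.support c hZ
  refine Lp_map_eq_gaussianReal_of_hasGaussianLaw (HasGaussianLaw.congr ?_ hsum.symm)
    ((integral_congr_ae hsum).trans ?_)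
  · exact (h.smul c).hasGaussianLaw_fun_sum
  · rw [integral_finsetSum _ fun i _ => ((hZ i).integrable (by norm_num)).const_mul _]
    simp only [integral_const_mul, h0, mul_zero, Finset.sum_const_zero]

end GaussianSubspace

section PathIntegrals

variable {Ω T : Type*} [MeasurableSpace Ω] [MeasurableSpace T] {P : Measure Ω} {ν : Measure T}
  {Y : T → Ω → ℝ}

lemma ae_memLp_two_path [SFinite ν] [SFinite P] (hY : MemLp (Function.uncurry Y) 2 (ν.prod P)) :
    ∀ᵐ ω ∂P, MemLp (fun t => Y t ω) 2 ν := by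
  have hmeas : ∀ᵐ ω ∂P, AEStronglyMeasurable (fun t => Y t ω) ν :=
    hY.aestronglyMeasurable.prod_swap.prodMk_left
  filter_upwards [hmeas, hY.integrable_sq.prod_left_ae] with ω hω hsq
  exact (memLp_two_iff_integrable_sq hω).2 hsq

lemma sq_integral_le_integral_sq [IsProbabilityMeasure ν] {f : T → ℝ} (hf : MemLp f 2 ν) :
    (∫ t, f t ∂ν) ^ 2 ≤ ∫ t, f t ^ 2 ∂ν := by
  have h := variance_nonneg f ν
  rw [variance_eq_sub hf] at h
  exact sub_nonneg.1 h

lemma memLp_two_integral_path [IsProbabilityMeasure ν] [IsFiniteMeasure P]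
    (hY : MemLp (Function.uncurry Y) 2 (ν.prod P)) : MemLp (fun ω => ∫ t, Y t ω ∂ν) 2 P := by
  have hmeas : AEStronglyMeasurable (fun ω => ∫ t, Y t ω ∂ν) P :=
    (hY.integrable (by norm_num)).integral_prod_right.aestronglyMeasurable
  rw [memLp_two_iff_integrable_sq hmeas]
  refine hY.integrable_sq.integral_prod_right.mono' (hmeas.pow 2) ?_
  filter_upwards [ae_memLp_two_path hY] with ω hω
  rw [Real.norm_of_nonneg (sq_nonneg _)]
  exact sq_integral_le_integral_sq hω

lemma integral_mul_integral_path [IsFiniteMeasure ν] [SFinite P]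
    (hY : MemLp (Function.uncurry Y) 2 (ν.prod P)) {V : Ω → ℝ} (hV : MemLp V 2 P) :
    ∫ ω, V ω * ∫ t, Y t ω ∂ν ∂P = ∫ t, ∫ ω, V ω * Y t ω ∂P ∂ν := by
  simp_rw [← integral_const_mul]
  exact (integral_integral_swap (f := fun t ω => V ω * Y t ω)
    ((hV.comp_snd ν).integrable_mul hY)).symm

end PathIntegrals

section UnitInterval

/-- Lebesgue measure on the unit interval. -/
noncomputable abbrev unitVolume : Measure ℝ := volume.restrict (Icc (0 : ℝ) 1)

instance : IsProbabilityMeasure unitVolume := ⟨by simp⟩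

lemma intervalIntegral_eq_integral_unitVolume (f : ℝ → ℝ) :
    ∫ t in (0 : ℝ)..1, f t = ∫ t, f t ∂unitVolume := by
  rw [intervalIntegral.integral_of_le zero_le_one, ← integral_Icc_eq_integral_Ioc]

lemma intervalIntegral_congr_Icc {f g : ℝ → ℝ} (h : EqOn f g (Icc 0 1)) :
    ∫ t in (0 : ℝ)..1, f t = ∫ t in (0 : ℝ)..1, g t :=
  intervalIntegral.integral_congr (by rwa [uIcc_of_le zero_le_one])

/-- The integral over `[0,1]` of a sample path against a weight. -/
noncomputable def weightedIntegral {Ω : Type*} (φ : ℝ → ℝ) (X : ℝ → Ω → ℝ) (ω : Ω) : ℝ :=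
  ∫ t in (0 : ℝ)..1, φ t * X t ω

lemma demean_eq_sub_weightedIntegral {Ω : Type*} (X : ℝ → Ω → ℝ) (t : ℝ) :
    demean X t = X t - weightedIntegral 1 X := by
  funext ω
  simp [demean, weightedIntegral]

variable {Ω : Type*} [MeasurableSpace Ω] {P : Measure Ω} {X : ℝ → Ω → ℝ} {φ : ℝ → ℝ}

lemma memLp_continuous_mul_uncurry [SFinite P] (hφ : Continuous φ)
    (h2 : MemLp (Function.uncurry X) 2 (unitVolume.prod P)) :
    MemLp (Function.uncurry fun t ω => φ t * X t ω) 2 (unitVolume.prod P) := by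
  obtain ⟨M, hM⟩ := isCompact_Icc.exists_bound_of_continuousOn (hφ.continuousOn (s := Icc 0 1))
  refine MemLp.of_le_mul (c := M) h2 ?_ ?_
  · exact (hφ.measurable.comp measurable_fst).aestronglyMeasurable.mul h2.1
  · have hmem : ∀ᵐ p ∂(unitVolume.prod P), p.1 ∈ Icc (0 : ℝ) 1 :=
      Measure.quasiMeasurePreserving_fst.ae (ae_restrict_mem measurableSet_Icc)
    filter_upwards [hmem] with p hp
    simp only [Function.uncurry, norm_mul]
    gcongr
    exact hM _ hp

lemma memLp_weightedIntegral [IsFiniteMeasure P] (hφ : Continuous φ)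
    (h2 : MemLp (Function.uncurry X) 2 (unitVolume.prod P)) :
    MemLp (weightedIntegral φ X) 2 P := by
  unfold weightedIntegral
  simp_rw [intervalIntegral_eq_integral_unitVolume]
  exact memLp_two_integral_path (memLp_continuous_mul_uncurry hφ h2)

lemma integral_mul_weightedIntegral [SFinite P] (hφ : Continuous φ)
    (h2 : MemLp (Function.uncurry X) 2 (unitVolume.prod P)) {V : Ω → ℝ} (hV : MemLp V 2 P) :
    ∫ ω, V ω * weightedIntegral φ X ω ∂P = ∫ s in (0 : ℝ)..1, φ s * ∫ ω, V ω * X s ω ∂P := by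
  simp only [weightedIntegral, intervalIntegral_eq_integral_unitVolume]
  rw [integral_mul_integral_path (memLp_continuous_mul_uncurry hφ h2) hV]
  simp_rw [mul_left_comm (V _) (φ _), integral_const_mul]

lemma covKernel_comm (X : ℝ → Ω → ℝ) (P : Measure Ω) (t s : ℝ) :
    covKernel X P t s = covKernel X P s t := by
  simp only [covKernel, mul_comm]

end UnitInterval

namespace IsCenteredGaussianOnUnit

variable {Ω : Type*} [MeasurableSpace Ω] {P : Measure Ω} {X : ℝ → Ω → ℝ} {φ ψ : ℝ → ℝ} {t s : ℝ}

lemma memLp_eval (hX : IsCenteredGaussianOnUnit X P) (ht : t ∈ Icc (0 : ℝ) 1) :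
    MemLp (X t) 2 P :=
  (hX.gaussian.hasGaussianLaw_eval ⟨t, ht⟩).memLp_two

lemma memLp_uncurry [SFinite P] (hX : IsCenteredGaussianOnUnit X P)
    (hc : ContinuousOn (Function.uncurry (covKernel X P)) (Icc 0 1 ×ˢ Icc 0 1)) :
    MemLp (Function.uncurry X) 2 (unitVolume.prod P) := by
  have hmeas := hX.aemeasurable.aestronglyMeasurable
  rw [memLp_two_iff_integrable_sq hmeas]
  refine (integrable_prod_iff (hmeas.pow 2)).2 ⟨?_, ?_⟩
  · filter_upwards [ae_restrict_mem measurableSet_Icc] with t ht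
    exact (hX.memLp_eval ht).integrable_sq
  · have hdiag : ContinuousOn (fun t => covKernel X P t t) (Icc 0 1) :=
      hc.comp (f := fun t => (t, t)) (by fun_prop) (fun t ht => ⟨ht, ht⟩)
    refine (hdiag.integrableOn_compact isCompact_Icc).congr (ae_of_all _ fun t => ?_)
    simp [covKernel, pow_two]

lemma integral_eval_mul_weightedIntegral [SFinite P] (hX : IsCenteredGaussianOnUnit X P)
    (hφ : Continuous φ) (h2 : MemLp (Function.uncurry X) 2 (unitVolume.prod P))
    (ht : t ∈ Icc (0 : ℝ) 1) :
    ∫ ω, X t ω * weightedIntegral φ X ω ∂P = ∫ s in (0 : ℝ)..1, φ s * covKernel X P t s :=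
  integral_mul_weightedIntegral hφ h2 (hX.memLp_eval ht)

lemma integral_weightedIntegral_mul [IsFiniteMeasure P] (hX : IsCenteredGaussianOnUnit X P)
    (hφ : Continuous φ) (hψ : Continuous ψ)
    (h2 : MemLp (Function.uncurry X) 2 (unitVolume.prod P)) :
    ∫ ω, weightedIntegral φ X ω * weightedIntegral ψ X ω ∂P =
      ∫ t in (0 : ℝ)..1, ψ t * ∫ s in (0 : ℝ)..1, φ s * covKernel X P t s := by
  rw [integral_mul_weightedIntegral hψ h2 (memLp_weightedIntegral hφ h2)]
  refine intervalIntegral_congr_Icc fun t ht => ?_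
  simp only [← hX.integral_eval_mul_weightedIntegral hφ h2 ht, mul_comm (X t _)]

/-- The closed linear span in `L²` of the values of the process. -/
noncomputable def closedSpan (hX : IsCenteredGaussianOnUnit X P) : Submodule ℝ (Lp ℝ 2 P) :=
  (Submodule.span ℝ (range fun t : Icc (0 : ℝ) 1 =>
    (hX.memLp_eval t.2).toLp (X t))).topologicalClosure

lemma isGaussianSubspace_closedSpan (hX : IsCenteredGaussianOnUnit X P) :
    IsGaussianSubspace hX.closedSpan :=
  have := hX.gaussian.isProbabilityMeasure
  (isGaussianSubspace_span_of_isGaussianProcess hX.gaussian (fun t => hX.memLp_eval t.2)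
    (fun t => hX.mean_zero t t.2)).topologicalClosure

lemma toLp_eval_mem_closedSpan (hX : IsCenteredGaussianOnUnit X P) (ht : t ∈ Icc (0 : ℝ) 1) :
    (hX.memLp_eval ht).toLp (X t) ∈ hX.closedSpan :=
  Submodule.le_topologicalClosure _ (Submodule.subset_span ⟨⟨t, ht⟩, rfl⟩)

lemma toLp_weightedIntegral_mem_closedSpan [IsFiniteMeasure P]
    (hX : IsCenteredGaussianOnUnit X P)
    (hφ : Continuous φ) (h2 : MemLp (Function.uncurry X) 2 (unitVolume.prod P)) :
    (memLp_weightedIntegral hφ h2).toLp (weightedIntegral φ X) ∈ hX.closedSpan := by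
  rw [closedSpan, ← Submodule.orthogonal_orthogonal_eq_closure, Submodule.mem_orthogonal]
  intro v hv
  have hv2 := Lp.memLp v
  have hvX : ∀ s ∈ Icc (0 : ℝ) 1, ∫ ω, v ω * X s ω ∂P = 0 := by
    intro s hs
    rw [← inner_toLp_eq_integral hv2 (hX.memLp_eval hs), Lp.toLp_coeFn]
    exact (Submodule.mem_orthogonal' _ _).1 hv _ (Submodule.subset_span ⟨⟨s, hs⟩, rfl⟩)
  rw [← Lp.toLp_coeFn v hv2, inner_toLp_eq_integral, integral_mul_weightedIntegral hφ h2 hv2,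
    intervalIntegral_congr_Icc (g := fun _ => 0) fun s hs => by simp only [hvX s hs, mul_zero],
    intervalIntegral.integral_zero]

lemma isGaussianProcess_weightedIntegral [IsFiniteMeasure P] (hX : IsCenteredGaussianOnUnit X P)
    {ι : Type*} {φ : ι → ℝ → ℝ} (hφ : ∀ i, Continuous (φ i))
    (h2 : MemLp (Function.uncurry X) 2 (unitVolume.prod P)) :
    IsGaussianProcess (fun i => weightedIntegral (φ i) X) P :=
  hX.isGaussianSubspace_closedSpan.isGaussianProcess (fun i => memLp_weightedIntegral (hφ i) h2)
    fun i => hX.toLp_weightedIntegral_mem_closedSpan (hφ i) h2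

lemma integral_weightedIntegral [IsFiniteMeasure P] (hX : IsCenteredGaussianOnUnit X P)
    (hφ : Continuous φ) (h2 : MemLp (Function.uncurry X) 2 (unitVolume.prod P)) :
    ∫ ω, weightedIntegral φ X ω ∂P = 0 :=
  hX.isGaussianSubspace_closedSpan.integral_eq_zero _
    (hX.toLp_weightedIntegral_mem_closedSpan hφ h2)

lemma memLp_demean [IsFiniteMeasure P] (hX : IsCenteredGaussianOnUnit X P)
    (h2 : MemLp (Function.uncurry X) 2 (unitVolume.prod P)) (ht : t ∈ Icc (0 : ℝ) 1) :
    MemLp (demean X t) 2 P := by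
  rw [demean_eq_sub_weightedIntegral]
  exact (hX.memLp_eval ht).sub (memLp_weightedIntegral continuous_one h2)

lemma toLp_demean_mem_closedSpan [IsFiniteMeasure P] (hX : IsCenteredGaussianOnUnit X P)
    (h2 : MemLp (Function.uncurry X) 2 (unitVolume.prod P)) (ht : t ∈ Icc (0 : ℝ) 1) :
    (hX.memLp_demean h2 ht).toLp (demean X t) ∈ hX.closedSpan := by
  simp_rw [demean_eq_sub_weightedIntegral]
  rw [MemLp.toLp_sub (hX.memLp_eval ht) (memLp_weightedIntegral continuous_one h2)]
  exact Submodule.sub_mem _ (hX.toLp_eval_mem_closedSpan ht)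
    (hX.toLp_weightedIntegral_mem_closedSpan continuous_one h2)

protected lemma demean [IsFiniteMeasure P] (hX : IsCenteredGaussianOnUnit X P)
    (h2 : MemLp (Function.uncurry X) 2 (unitVolume.prod P)) :
    IsCenteredGaussianOnUnit (demean X) P where
  gaussian := hX.isGaussianSubspace_closedSpan.isGaussianProcess
    (fun t => hX.memLp_demean h2 t.2) fun t => hX.toLp_demean_mem_closedSpan h2 t.2
  mean_zero t ht := hX.isGaussianSubspace_closedSpan.integral_eq_zero _
    (hX.toLp_demean_mem_closedSpan h2 ht)
  aemeasurable := by
    have hsplit : Function.uncurry (demean X) = fun p : ℝ × Ω =>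
        Function.uncurry X p - weightedIntegral 1 X p.2 := by
      funext p
      simp only [Function.uncurry, demean_eq_sub_weightedIntegral, Pi.sub_apply]
    rw [hsplit]
    exact hX.aemeasurable.sub
      (memLp_weightedIntegral continuous_one h2).aestronglyMeasurable.comp_snd.aemeasurable

lemma covKernel_demean [IsFiniteMeasure P] (hX : IsCenteredGaussianOnUnit X P)
    (h2 : MemLp (Function.uncurry X) 2 (unitVolume.prod P)) (ht : t ∈ Icc (0 : ℝ) 1)
    (hs : s ∈ Icc (0 : ℝ) 1) :
    covKernel (demean X) P t s = doublyCentered (covKernel X P) t s := by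
  set M := weightedIntegral 1 X
  have hM2 : MemLp M 2 P := memLp_weightedIntegral continuous_one h2
  have hXM : ∀ t ∈ Icc (0 : ℝ) 1, ∫ ω, X t ω * M ω ∂P = ∫ r in (0 : ℝ)..1, covKernel X P t r := by
    intro t ht
    rw [hX.integral_eval_mul_weightedIntegral continuous_one h2 ht]
    simp only [Pi.one_apply, one_mul]
  have hMM : ∫ ω, M ω * M ω ∂P = ∫ x in (0 : ℝ)..1, ∫ y in (0 : ℝ)..1, covKernel X P x y := by
    rw [hX.integral_weightedIntegral_mul continuous_one continuous_one h2]
    simp only [Pi.one_apply, one_mul]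
  have hexpand : ∀ ω, demean X t ω * demean X s ω =
      X t ω * X s ω - X t ω * M ω - X s ω * M ω + M ω * M ω := by
    intro ω
    simp only [demean_eq_sub_weightedIntegral, Pi.sub_apply]
    ring
  have iXX : Integrable (fun ω => X t ω * X s ω) P :=
    (hX.memLp_eval ht).integrable_mul (hX.memLp_eval hs)
  have iXM : ∀ t ∈ Icc (0 : ℝ) 1, Integrable (fun ω => X t ω * M ω) P :=
    fun t ht => (hX.memLp_eval ht).integrable_mul hM2
  have iMM : Integrable (fun ω => M ω * M ω) P := hM2.integrable_mul hM2
  rw [covKernel]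
  simp_rw [hexpand]
  rw [integral_add (by exact (iXX.sub (iXM t ht)).sub (iXM s hs)) iMM,
    integral_sub (by exact iXX.sub (iXM t ht)) (iXM s hs),
    integral_sub iXX (iXM t ht), hXM t ht, hXM s hs, hMM, doublyCentered]
  simp only [covKernel_comm X P s]
  rfl

end IsCenteredGaussianOnUnit

section CosineBasis

/-- The `L²(0,1)`-normalized nonconstant Neumann eigenfunctions `√2 cos(π(k+1)t)`. -/
noncomputable def cosBasis (k : ℕ) (t : ℝ) : ℝ := √2 * Real.cos (Real.pi * (k + 1) * t)

lemma continuous_cosBasis (k : ℕ) : Continuous (cosBasis k) := by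
  unfold cosBasis
  fun_prop

lemma integral_cos_pi_int_mul {n : ℤ} (hn : n ≠ 0) :
    ∫ t in (0 : ℝ)..1, Real.cos (Real.pi * n * t) = 0 := by
  have h : Real.pi * n ≠ 0 := mul_ne_zero Real.pi_ne_zero (by exact_mod_cast hn)
  rw [intervalIntegral.integral_comp_mul_left _ h]
  simp [mul_comm Real.pi, Real.sin_int_mul_pi]

lemma cosBasis_mul_cosBasis (j k : ℕ) (t : ℝ) :
    cosBasis j t * cosBasis k t =
      Real.cos (Real.pi * (j - k : ℤ) * t) + Real.cos (Real.pi * (j + k + 2 : ℤ) * t) := by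
  have hsub : Real.pi * ((j - k : ℤ) : ℝ) * t =
      Real.pi * (j + 1) * t - Real.pi * (k + 1) * t := by push_cast; ring
  have hadd : Real.pi * ((j + k + 2 : ℤ) : ℝ) * t =
      Real.pi * (j + 1) * t + Real.pi * (k + 1) * t := by push_cast; ring
  rw [hsub, hadd, Real.cos_sub, Real.cos_add, cosBasis, cosBasis]
  linear_combination (Real.cos (Real.pi * (j + 1) * t) * Real.cos (Real.pi * (k + 1) * t)) *
    Real.mul_self_sqrt (zero_le_two (α := ℝ))

lemma integral_cosBasis_mul_cosBasis (j k : ℕ) :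
    ∫ t in (0 : ℝ)..1, cosBasis j t * cosBasis k t = if j = k then 1 else 0 := by
  simp_rw [cosBasis_mul_cosBasis]
  rw [intervalIntegral.integral_add (Continuous.intervalIntegrable (by fun_prop) _ _)
    (Continuous.intervalIntegrable (by fun_prop) _ _),
    integral_cos_pi_int_mul (n := j + k + 2) (by omega)]
  split_ifs with hjk
  · simp [hjk]
  · rw [integral_cos_pi_int_mul (by omega), add_zero]

lemma hasDerivAt_half_sq_add_mul_cos {w : ℝ} (hw : w ≠ 0) (a b r : ℝ) :
    HasDerivAt (fun r => (r ^ 2 / 2 + a * r + b) * Real.sin (w * r) / w +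
      (r + a) * Real.cos (w * r) / w ^ 2 - Real.sin (w * r) / w ^ 3)
      ((r ^ 2 / 2 + a * r + b) * Real.cos (w * r)) r := by
  have hs : HasDerivAt (fun r => Real.sin (w * r)) (Real.cos (w * r) * w) r := by
    simpa using ((hasDerivAt_id r).const_mul w).sin
  have hc : HasDerivAt (fun r => Real.cos (w * r)) (-Real.sin (w * r) * w) r := by
    simpa using ((hasDerivAt_id r).const_mul w).cos
  have hq := hasDerivAt_half_sq_add a b r
  have hl : HasDerivAt (fun r : ℝ => r + a) 1 r := (hasDerivAt_id r).add_const a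
  refine ((((hq.mul hs).div_const w).add ((hl.mul hc).div_const (w ^ 2))).sub
    (hs.div_const (w ^ 3))).congr_deriv ?_
  field_simp
  ring

lemma integral_half_sq_add_mul_cos {w : ℝ} (hw : w ≠ 0) (a b x y : ℝ) :
    ∫ r in x..y, (r ^ 2 / 2 + a * r + b) * Real.cos (w * r) =
      ((y ^ 2 / 2 + a * y + b) * Real.sin (w * y) / w +
        (y + a) * Real.cos (w * y) / w ^ 2 - Real.sin (w * y) / w ^ 3) -
      ((x ^ 2 / 2 + a * x + b) * Real.sin (w * x) / w +
        (x + a) * Real.cos (w * x) / w ^ 2 - Real.sin (w * x) / w ^ 3) :=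
  intervalIntegral.integral_eq_sub_of_hasDerivAt
    (fun r _ => hasDerivAt_half_sq_add_mul_cos hw a b r)
    (Continuous.intervalIntegrable (by fun_prop) _ _)

lemma integral_cosBasis_mul_neumannKernel (k : ℕ) {s : ℝ} (hs : s ∈ Icc (0 : ℝ) 1) :
    ∫ r in (0 : ℝ)..1, cosBasis k r * neumannKernel s r =
      1 / (Real.pi * (k + 1)) ^ 2 * cosBasis k s := by
  have hw : Real.pi * ((k : ℝ) + 1) ≠ 0 := mul_ne_zero Real.pi_ne_zero (by positivity)
  have hsin : Real.sin (Real.pi * ((k : ℝ) + 1) * 1) = 0 := by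
    have h := Real.sin_nat_mul_pi (k + 1)
    push_cast at h
    rw [mul_one, mul_comm, h]
  unfold cosBasis
  set w := Real.pi * ((k : ℝ) + 1)
  rw [intervalIntegral_eq_add_of_eqOn hs
    (g := fun r => √2 * ((r ^ 2 / 2 + 0 * r + (1 / 3 - (s - s ^ 2 / 2))) * Real.cos (w * r)))
    (h := fun r => √2 * ((r ^ 2 / 2 + (-1) * r + (1 / 3 + s ^ 2 / 2)) * Real.cos (w * r)))
    (by fun_prop) (by fun_prop)
    (fun r hr => by simp only [neumannKernel, min_eq_right hr.2]; ring)
    (fun r hr => by simp only [neumannKernel, min_eq_left hr.1]; ring),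
    intervalIntegral.integral_const_mul, intervalIntegral.integral_const_mul,
    integral_half_sq_add_mul_cos hw, integral_half_sq_add_mul_cos hw, hsin]
  simp only [mul_zero, Real.sin_zero, Real.cos_zero]
  field_simp
  ring

lemma hasSum_one_div_pi_mul_sq :
    HasSum (fun k : ℕ => 1 / (Real.pi * ((k : ℝ) + 1)) ^ 2) (1 / 6) := by
  have h := ((hasSum_nat_add_iff' 1).2 hasSum_zeta_two).mul_left (1 / Real.pi ^ 2)
  have hval : 1 / Real.pi ^ 2 * (Real.pi ^ 2 / 6 - ∑ i ∈ Finset.range 1, 1 / (i : ℝ) ^ 2) =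
      1 / 6 := by
    have := Real.pi_pos
    simp
    field_simp
  rw [hval] at h
  refine h.congr_fun fun k => ?_
  push_cast
  rw [mul_pow, one_div_mul_one_div]

/-- Continuous `L²(0,1)`-orthonormal eigenfunctions `φ k`, with eigenvalues `c k`, of the integral
operator on `[0,1]` with kernel `K`. In place of completeness one asks that the eigenvalues add up
to the trace of `K`. -/
structure IsEigenExpansion (K : ℝ → ℝ → ℝ) (φ : ℕ → ℝ → ℝ) (c : ℕ → ℝ) : Prop where
  continuous : ∀ k, Continuous (φ k)
  orthonormal : ∀ j k, ∫ t in (0 : ℝ)..1, φ j t * φ k t = if j = k then 1 else 0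
  eigen : ∀ k, ∀ t ∈ Icc (0 : ℝ) 1, ∫ s in (0 : ℝ)..1, φ k s * K t s = c k * φ k t
  trace : HasSum c (∫ t in (0 : ℝ)..1, K t t)

lemma IsEigenExpansion.congr {K K' : ℝ → ℝ → ℝ} {φ : ℕ → ℝ → ℝ} {c : ℕ → ℝ}
    (h : IsEigenExpansion K φ c)
    (hK : ∀ t ∈ Icc (0 : ℝ) 1, ∀ s ∈ Icc (0 : ℝ) 1, K' t s = K t s) :
    IsEigenExpansion K' φ c where
  continuous := h.continuous
  orthonormal := h.orthonormal
  eigen k t ht := by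
    rw [← h.eigen k t ht]
    exact intervalIntegral_congr_Icc fun s hs => by simp only [hK t ht s hs]
  trace := by
    rw [intervalIntegral_congr_Icc fun t ht => hK t ht t ht]
    exact h.trace

lemma isEigenExpansion_neumannKernel :
    IsEigenExpansion neumannKernel cosBasis fun k => 1 / (Real.pi * (k + 1)) ^ 2 where
  continuous := continuous_cosBasis
  orthonormal := integral_cosBasis_mul_cosBasis
  eigen k _ ht := integral_cosBasis_mul_neumannKernel k ht
  trace := integral_neumannKernel_diag ▸ hasSum_one_div_pi_mul_sq

end CosineBasis

section GaussianQuadraticForms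

variable {Ω : Type*} [MeasurableSpace Ω] {P : Measure Ω}

lemma mgf_sq_gaussianReal {s : ℝ} (hs : 0 ≤ s) (v : NNReal) :
    mgf (fun x => x ^ 2) (gaussianReal 0 v) (-s) = (√(1 + 2 * s * v))⁻¹ := by
  rcases eq_or_ne v 0 with rfl | hv
  · simp [mgf]
  have : (0 : ℝ) < v := by exact_mod_cast pos_iff_ne_zero.2 hv
  rw [mgf, integral_gaussianReal_eq_integral_smul hv]
  have hmerge : ∀ x : ℝ, gaussianPDFReal 0 v x • Real.exp (-s * x ^ 2) =
      (√(2 * Real.pi * v))⁻¹ * Real.exp (-(1 / (2 * v) + s) * x ^ 2) := by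
    intro x
    rw [gaussianPDFReal, smul_eq_mul, mul_assoc, ← Real.exp_add]
    congr 2
    field_simp
    ring
  simp_rw [hmerge]
  rw [integral_const_mul, integral_gaussian, ← Real.sqrt_inv, ← Real.sqrt_inv,
    ← Real.sqrt_mul (by positivity)]
  congr 1
  have := Real.pi_pos
  field_simp

lemma mgf_sq_of_hasGaussianLaw [IsProbabilityMeasure P] {Z : Ω → ℝ} (hZ : HasGaussianLaw Z P)
    (h0 : ∫ ω, Z ω ∂P = 0) {s : ℝ} (hs : 0 ≤ s) :
    mgf (fun ω => Z ω ^ 2) P (-s) = (√(1 + 2 * s * ∫ ω, Z ω * Z ω ∂P))⁻¹ := by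
  have hlaw := hZ.map_eq_gaussianReal
  rw [h0, variance_of_integral_eq_zero hZ.aemeasurable h0] at hlaw
  simp_rw [← pow_two]
  rw [← Real.coe_toNNReal (∫ ω, Z ω ^ 2 ∂P) (integral_nonneg fun _ => sq_nonneg _),
    ← mgf_sq_gaussianReal hs, ← hlaw, mgf_map hZ.aemeasurable (by fun_prop)]
  rfl

lemma iIndepFun_of_isGaussianProcess {ι : Type*} {Z : ι → Ω → ℝ} (hZ : IsGaussianProcess Z P)
    (h0 : ∀ i, ∫ ω, Z i ω ∂P = 0) (h : ∀ i j, i ≠ j → ∫ ω, Z i ω * Z j ω ∂P = 0) (I : Finset ι) :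
    iIndepFun (fun i : I => Z i) P := by
  have := hZ.isProbabilityMeasure
  refine (hZ.hasGaussianLaw I).iIndepFun_of_covariance_eq_zero fun i j hij => ?_
  change cov[Z i, Z j; P] = 0
  rw [covariance_eq_sub (hZ.hasGaussianLaw_eval i).memLp_two (hZ.hasGaussianLaw_eval j).memLp_two,
    h0, zero_mul, sub_zero]
  exact h i j (Subtype.coe_ne_coe.2 hij)

lemma mgf_sum_sq_of_isGaussianProcess {ι : Type*} {Z : ι → Ω → ℝ} (hZ : IsGaussianProcess Z P)
    (h0 : ∀ i, ∫ ω, Z i ω ∂P = 0) (h : ∀ i j, i ≠ j → ∫ ω, Z i ω * Z j ω ∂P = 0) {s : ℝ}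
    (hs : 0 ≤ s) (I : Finset ι) :
    mgf (fun ω => ∑ i ∈ I, Z i ω ^ 2) P (-s) =
      ∏ i ∈ I, (√(1 + 2 * s * ∫ ω, Z i ω * Z i ω ∂P))⁻¹ := by
  have := hZ.isProbabilityMeasure
  have hind : iIndepFun (fun (i : I) ω => Z i ω ^ 2) P :=
    (iIndepFun_of_isGaussianProcess hZ h0 h I).comp (fun _ x => x ^ 2) fun _ => by fun_prop
  have hsum : (fun ω => ∑ i ∈ I, Z i ω ^ 2) = ∑ i : I, fun ω => Z i ω ^ 2 := by
    funext ω
    rw [Finset.sum_apply, Finset.sum_coe_sort I fun i => Z i ω ^ 2]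
  rw [hsum, hind.mgf_sum₀ fun i => (hZ.hasGaussianLaw_eval i).aemeasurable.pow_const 2,
    ← Finset.prod_coe_sort I]
  exact Finset.prod_congr rfl fun i _ =>
    mgf_sq_of_hasGaussianLaw (hZ.hasGaussianLaw_eval i) (h0 i) hs

end GaussianQuadraticForms

section MomentGeneratingFunction

variable {Ω : Type*} [MeasurableSpace Ω] {P : Measure Ω} {f g : Ω → ℝ} {s : ℝ}

lemma integrable_exp_neg_mul [IsFiniteMeasure P] (hf : AEMeasurable f P) (hf0 : ∀ᵐ ω ∂P, 0 ≤ f ω)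
    (hs : 0 ≤ s) : Integrable (fun ω => Real.exp (-s * f ω)) P := by
  refine Integrable.of_bound (C := 1) (by fun_prop) ?_
  filter_upwards [hf0] with ω hω
  rw [Real.norm_of_nonneg (Real.exp_nonneg _), Real.exp_le_one_iff, neg_mul]
  exact neg_nonpos.2 (mul_nonneg hs hω)

lemma abs_exp_neg_sub_exp_neg_le {x y : ℝ} (hx : 0 ≤ x) (hy : 0 ≤ y) :
    |Real.exp (-x) - Real.exp (-y)| ≤ |x - y| := by
  wlog hxy : x ≤ y generalizing x y
  · rw [abs_sub_comm, abs_sub_comm x]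
    exact this hy hx (le_of_not_ge hxy)
  have hsplit : Real.exp (-y) = Real.exp (-x) * Real.exp (-(y - x)) := by
    rw [← Real.exp_add]
    congr 1
    ring
  have hle : Real.exp (-x) ≤ 1 := Real.exp_le_one_iff.2 (neg_nonpos.2 hx)
  have hlin := Real.one_sub_le_exp_neg (y - x)
  rw [abs_of_nonneg (sub_nonneg.2 (Real.exp_le_exp.2 (neg_le_neg hxy))), abs_sub_comm,
    abs_of_nonneg (sub_nonneg.2 hxy), hsplit]
  nlinarith [Real.exp_pos (-x), sub_nonneg.2 hxy]

lemma abs_mgf_neg_sub_le [IsFiniteMeasure P] (hf : Integrable f P) (hg : Integrable g P)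
    (hf0 : ∀ᵐ ω ∂P, 0 ≤ f ω) (hg0 : ∀ᵐ ω ∂P, 0 ≤ g ω) (hs : 0 ≤ s) :
    |mgf f P (-s) - mgf g P (-s)| ≤ s * ∫ ω, |f ω - g ω| ∂P := by
  have hef := integrable_exp_neg_mul hf.aemeasurable hf0 hs
  have heg := integrable_exp_neg_mul hg.aemeasurable hg0 hs
  rw [mgf, mgf, ← integral_sub hef heg, ← integral_const_mul]
  refine abs_integral_le_integral_abs.trans
    (integral_mono_ae (hef.sub heg).abs ((hf.sub hg).abs.const_mul s) ?_)
  filter_upwards [hf0, hg0] with ω hfω hgω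
  have h := abs_exp_neg_sub_exp_neg_le (mul_nonneg hs hfω) (mul_nonneg hs hgω)
  rwa [← mul_sub, abs_mul, abs_of_nonneg hs, ← neg_mul, ← neg_mul] at h

end MomentGeneratingFunction

section SquaredNorm

/-- The squared `L²(0,1)` norm of a sample path. -/
noncomputable def sqNorm {Ω : Type*} (X : ℝ → Ω → ℝ) (ω : Ω) : ℝ :=
  ∫ t in (0 : ℝ)..1, X t ω ^ 2

lemma sqNorm_nonneg {Ω : Type*} (X : ℝ → Ω → ℝ) (ω : Ω) : 0 ≤ sqNorm X ω :=
  intervalIntegral.integral_nonneg zero_le_one fun _ _ => sq_nonneg _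

variable {Ω : Type*} [MeasurableSpace Ω] {P : Measure Ω} {Y : ℝ → Ω → ℝ} {φ : ℕ → ℝ → ℝ}

lemma integrable_sqNorm [SFinite P] (h2 : MemLp (Function.uncurry Y) 2 (unitVolume.prod P)) :
    Integrable (sqNorm Y) P := by
  refine h2.integrable_sq.integral_prod_right.congr (ae_of_all _ fun ω => ?_)
  simp only [sqNorm, intervalIntegral_eq_integral_unitVolume, Function.uncurry]

lemma integral_sqNorm [SFinite P] (h2 : MemLp (Function.uncurry Y) 2 (unitVolume.prod P)) :
    ∫ ω, sqNorm Y ω ∂P = ∫ t in (0 : ℝ)..1, covKernel Y P t t := by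
  simp only [sqNorm, intervalIntegral_eq_integral_unitVolume, covKernel, ← pow_two]
  exact (integral_integral_swap (f := fun t ω => Y t ω ^ 2) h2.integrable_sq).symm

lemma memLp_two_unitVolume_of_continuous {f : ℝ → ℝ} (hf : Continuous f) :
    MemLp f 2 unitVolume := by
  rw [memLp_two_iff_integrable_sq hf.aestronglyMeasurable]
  exact (hf.pow 2).continuousOn.integrableOn_compact isCompact_Icc

lemma sum_sq_integral_mul_le (hφ : ∀ k, Continuous (φ k))
    (ho : ∀ j k, ∫ t in (0 : ℝ)..1, φ j t * φ k t = if j = k then 1 else 0) {f : ℝ → ℝ}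
    (hf : MemLp f 2 unitVolume) (n : ℕ) :
    ∑ k ∈ Finset.range n, (∫ t in (0 : ℝ)..1, φ k t * f t) ^ 2 ≤ ∫ t in (0 : ℝ)..1, f t ^ 2 := by
  have hL := fun k => memLp_two_unitVolume_of_continuous (hφ k)
  have horth : Orthonormal ℝ fun k => (hL k).toLp (φ k) := by
    rw [orthonormal_iff_ite]
    intro j k
    rw [inner_toLp_eq_integral, ← intervalIntegral_eq_integral_unitVolume, ho]
  have hbessel := horth.sum_inner_products_le (hf.toLp f) (s := Finset.range n)
  rw [← real_inner_self_eq_norm_sq, inner_toLp_eq_integral] at hbessel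
  simpa only [intervalIntegral_eq_integral_unitVolume, inner_toLp_eq_integral, Real.norm_eq_abs,
    sq_abs, ← pow_two] using hbessel

end SquaredNorm

namespace IsCenteredGaussianOnUnit

variable {Ω : Type*} [MeasurableSpace Ω] {P : Measure Ω} [IsProbabilityMeasure P] {Y : ℝ → Ω → ℝ}
  {φ : ℕ → ℝ → ℝ} {c : ℕ → ℝ}

lemma integral_coeff_mul_coeff (hY : IsCenteredGaussianOnUnit Y P)
    (h2 : MemLp (Function.uncurry Y) 2 (unitVolume.prod P))
    (h : IsEigenExpansion (covKernel Y P) φ c) (j k : ℕ) :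
    ∫ ω, weightedIntegral (φ j) Y ω * weightedIntegral (φ k) Y ω ∂P = if j = k then c k else 0 := by
  rw [hY.integral_weightedIntegral_mul (h.continuous j) (h.continuous k) h2,
    intervalIntegral_congr_Icc (g := fun t => c j * (φ j t * φ k t)) fun t ht => by
      simp only [h.eigen j t ht, mul_left_comm, mul_comm],
    intervalIntegral.integral_const_mul, h.orthonormal]
  split_ifs with hjk
  · rw [hjk, mul_one]
  · rw [mul_zero]

lemma mgf_sum_sq_coeff (hY : IsCenteredGaussianOnUnit Y P)
    (h2 : MemLp (Function.uncurry Y) 2 (unitVolume.prod P))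
    (h : IsEigenExpansion (covKernel Y P) φ c) {s : ℝ} (hs : 0 ≤ s) (n : ℕ) :
    mgf (fun ω => ∑ k ∈ Finset.range n, weightedIntegral (φ k) Y ω ^ 2) P (-s) =
      ∏ k ∈ Finset.range n, (√(1 + 2 * s * c k))⁻¹ := by
  rw [mgf_sum_sq_of_isGaussianProcess (hY.isGaussianProcess_weightedIntegral h.continuous h2)
    (fun k => hY.integral_weightedIntegral (h.continuous k) h2)
    (fun j k hjk => by rw [hY.integral_coeff_mul_coeff h2 h, if_neg hjk]) hs]
  simp only [hY.integral_coeff_mul_coeff h2 h, if_true]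

lemma integral_abs_sum_sq_coeff_sub_sqNorm (hY : IsCenteredGaussianOnUnit Y P)
    (h2 : MemLp (Function.uncurry Y) 2 (unitVolume.prod P))
    (h : IsEigenExpansion (covKernel Y P) φ c) (n : ℕ) :
    ∫ ω, |∑ k ∈ Finset.range n, weightedIntegral (φ k) Y ω ^ 2 - sqNorm Y ω| ∂P =
      (∫ t in (0 : ℝ)..1, covKernel Y P t t) - ∑ k ∈ Finset.range n, c k := by
  have hsq : ∀ k, Integrable (fun ω => weightedIntegral (φ k) Y ω ^ 2) P :=
    fun k => (memLp_weightedIntegral (h.continuous k) h2).integrable_sq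
  have habs : ∀ᵐ ω ∂P, |∑ k ∈ Finset.range n, weightedIntegral (φ k) Y ω ^ 2 - sqNorm Y ω| =
      sqNorm Y ω - ∑ k ∈ Finset.range n, weightedIntegral (φ k) Y ω ^ 2 := by
    filter_upwards [ae_memLp_two_path h2] with ω hω
    rw [abs_sub_comm]
    exact abs_of_nonneg (sub_nonneg.2 (sum_sq_integral_mul_le h.continuous h.orthonormal hω n))
  rw [integral_congr_ae habs, integral_sub (integrable_sqNorm h2)
    (integrable_finsetSum _ fun k _ => hsq k), integral_sqNorm h2,
    integral_finsetSum _ fun k _ => hsq k]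
  congr 1
  refine Finset.sum_congr rfl fun k _ => ?_
  simp only [pow_two, hY.integral_coeff_mul_coeff h2 h, if_true]

lemma tendsto_prod_mgf_sqNorm (hY : IsCenteredGaussianOnUnit Y P)
    (h2 : MemLp (Function.uncurry Y) 2 (unitVolume.prod P))
    (h : IsEigenExpansion (covKernel Y P) φ c) {s : ℝ} (hs : 0 ≤ s) :
    Tendsto (fun n => ∏ k ∈ Finset.range n, (√(1 + 2 * s * c k))⁻¹) atTop
      (𝓝 (mgf (sqNorm Y) P (-s))) := by
  have hdiff : Tendsto (fun n => s * ((∫ t in (0 : ℝ)..1, covKernel Y P t t) -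
      ∑ k ∈ Finset.range n, c k)) atTop (𝓝 0) := by
    simpa using (h.trace.tendsto_sum_nat.const_sub
      (∫ t in (0 : ℝ)..1, covKernel Y P t t)).const_mul s
  simp_rw [← hY.mgf_sum_sq_coeff h2 h hs]
  rw [tendsto_iff_norm_sub_tendsto_zero]
  refine squeeze_zero (fun _ => norm_nonneg _) (fun n => ?_) hdiff
  rw [← hY.integral_abs_sum_sq_coeff_sub_sqNorm h2 h n]
  refine abs_mgf_neg_sub_le (integrable_finsetSum _ fun k _ => ?_) (integrable_sqNorm h2)
    (ae_of_all _ fun ω => Finset.sum_nonneg fun k _ => sq_nonneg _)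
    (ae_of_all _ (sqNorm_nonneg Y)) hs
  exact (memLp_weightedIntegral (h.continuous k) h2).integrable_sq

end IsCenteredGaussianOnUnit

section NeumannLaplaceTransform

lemma tendsto_euler_sinh_prod (x : ℝ) :
    Tendsto (fun n : ℕ => x * ∏ k ∈ Finset.range n, (1 + x ^ 2 / (Real.pi * (k + 1)) ^ 2)) atTop
      (𝓝 (Real.sinh x)) := by
  have hpi : (Real.pi : ℂ) ≠ 0 := by exact_mod_cast Real.pi_ne_zero
  have hxI : (Real.pi : ℂ) * (x / Real.pi * Complex.I) = x * Complex.I := by field_simp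
  have hsin : Complex.sin (x * Complex.I) = (Real.sinh x : ℝ) * Complex.I := by
    rw [Complex.sin_mul_I, Complex.ofReal_sinh]
  have hprod : ∀ n, (x * Complex.I) *
      ∏ k ∈ Finset.range n, ((1 : ℂ) - (x / Real.pi * Complex.I) ^ 2 / ((k : ℂ) + 1) ^ 2) =
      ((x * ∏ k ∈ Finset.range n, (1 + x ^ 2 / (Real.pi * (k + 1)) ^ 2) : ℝ) : ℂ) * Complex.I := by
    intro n
    push_cast
    rw [mul_right_comm]
    congr 2
    refine Finset.prod_congr rfl fun k _ => ?_
    rw [mul_pow, Complex.I_sq, div_pow, mul_pow, mul_neg_one, neg_div, sub_neg_eq_add, div_div]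
  have h := Complex.tendsto_euler_sin_prod (x / Real.pi * Complex.I)
  rw [hxI, hsin] at h
  simpa only [hprod, Function.comp_def, Complex.im_ofReal_mul, Complex.I_im, mul_one] using
    (Complex.continuous_im.tendsto _).comp h

lemma IsCenteredGaussianOnUnit.mgf_sqNorm_of_neumannKernel {Ω : Type*} [MeasurableSpace Ω]
    {P : Measure Ω} [IsProbabilityMeasure P] {Y : ℝ → Ω → ℝ} (hY : IsCenteredGaussianOnUnit Y P)
    (h2 : MemLp (Function.uncurry Y) 2 (unitVolume.prod P))
    (hK : ∀ t ∈ Icc (0 : ℝ) 1, ∀ s ∈ Icc (0 : ℝ) 1, covKernel Y P t s = neumannKernel t s)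
    {θ : ℝ} (hθ : 0 < θ) :
    mgf (sqNorm Y) P (-(θ ^ 2 / 2)) = √(θ / Real.sinh θ) := by
  have hpos : 0 < Real.sinh θ / θ := div_pos (Real.sinh_pos_iff.2 hθ) hθ
  have heuler : Tendsto (fun n : ℕ => ∏ k ∈ Finset.range n,
      (1 + θ ^ 2 / (Real.pi * (k + 1)) ^ 2)) atTop (𝓝 (Real.sinh θ / θ)) := by
    simpa only [mul_div_cancel_left₀ _ hθ.ne'] using (tendsto_euler_sinh_prod θ).div_const θ
  have hlim := heuler.sqrt.inv₀ (Real.sqrt_pos.2 hpos).ne'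
  rw [← Real.sqrt_inv, inv_div] at hlim
  refine tendsto_nhds_unique (hY.tendsto_prod_mgf_sqNorm h2
    (isEigenExpansion_neumannKernel.congr hK) (by positivity)) (hlim.congr fun n => ?_)
  rw [Real.sqrt_prod _ fun k _ => by positivity, ← Finset.prod_inv_distrib]
  refine Finset.prod_congr rfl fun k _ => ?_
  congr 3
  ring

end NeumannLaplaceTransform

section LaplaceUniqueness

variable {μ ν : Measure ℝ} [IsFiniteMeasure μ] [IsFiniteMeasure ν]

lemma measure_ext_of_moments {a b : ℝ} (hμ : ∀ᵐ x ∂μ, x ∈ Icc a b) (hν : ∀ᵐ x ∂ν, x ∈ Icc a b)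
    (h : ∀ n : ℕ, ∫ x, x ^ n ∂μ = ∫ x, x ^ n ∂ν) : μ = ν := by
  have hset {ρ : Measure ℝ} [IsFiniteMeasure ρ] (hρ : ∀ᵐ x ∂ρ, x ∈ Icc a b) :
      interior (integrableExpSet id ρ) = univ := by
    rw [show integrableExpSet id ρ = univ from
      eq_univ_of_forall fun t => integrable_exp_mul_of_mem_Icc aemeasurable_id hρ, interior_univ]
  have hmgf : mgf id μ = mgf id ν := by
    refine AnalyticOnNhd.eq_of_eventuallyEq (z₀ := 0) (hset hμ ▸ analyticOnNhd_mgf)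
      (hset hν ▸ analyticOnNhd_mgf) ?_
    have hμs := hasFPowerSeriesAt_mgf (X := id) (μ := μ) (v := 0) (by simp [hset hμ])
    have hνs := hasFPowerSeriesAt_mgf (X := id) (μ := ν) (v := 0) (by simp [hset hν])
    simp only [id_eq, zero_mul, Real.exp_zero, mul_one, h] at hμs hνs
    filter_upwards [hμs.eventually_hasSum_sub, hνs.eventually_hasSum_sub] with t hμt hνt
    exact hμt.unique hνt
  have hzero : μ = 0 ↔ ν = 0 := by
    have hmass : μ.real univ = ν.real univ := by simpa using h 0
    rw [← Measure.measure_univ_eq_zero, ← Measure.measure_univ_eq_zero, ← measureReal_eq_zero_iff,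
      ← measureReal_eq_zero_iff, hmass]
  refine Measure.ext_of_complexMGF_id_eq (funext fun z => ?_)
  exact eqOn_complexMGF_of_mgf' hmgf hzero (by simp [hset hμ])

/-- Substituting `y = e^{-x}` turns the Laplace transform at the integers into moments. -/
lemma measure_ext_of_mgf_neg_natCast (hμ : ∀ᵐ x ∂μ, 0 ≤ x) (hν : ∀ᵐ x ∂ν, 0 ≤ x)
    (h : ∀ n : ℕ, mgf id μ (-n) = mgf id ν (-n)) : μ = ν := by
  have hemb : MeasurableEmbedding fun x : ℝ => Real.exp (-x) :=
    Continuous.measurableEmbedding (by fun_prop) (Real.exp_injective.comp neg_injective)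
  have hmem {ρ : Measure ℝ} (hρ : ∀ᵐ x ∂ρ, 0 ≤ x) :
      ∀ᵐ y ∂ρ.map (fun x => Real.exp (-x)), y ∈ Icc (0 : ℝ) 1 := by
    rw [hemb.ae_map_iff]
    filter_upwards [hρ] with x hx
    simpa [Real.exp_nonneg] using hx
  have hmoment (ρ : Measure ℝ) (n : ℕ) :
      ∫ y, y ^ n ∂ρ.map (fun x => Real.exp (-x)) = mgf id ρ (-n) := by
    simp [hemb.integral_map, mgf, ← Real.exp_nat_mul]
  rw [← hemb.comap_map μ, ← hemb.comap_map ν]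
  congr 1
  exact measure_ext_of_moments (hmem hμ) (hmem hν) fun n => by simp only [hmoment, h]

end LaplaceUniqueness

section LaplaceTransform

/-- The one-sided Laplace transform `∫₀^∞ e^{-st} f(t) dt` of an extended nonnegative function; its
values lie in `[0, ∞]`, so that sums and integrals may be exchanged freely. -/
noncomputable def laplaceTransform (f : ℝ → ENNReal) (s : ℝ) : ENNReal :=
  ∫⁻ t in Ioi (0 : ℝ), ENNReal.ofReal (Real.exp (-(s * t))) * f t

lemma laplaceTransform_const_mul {a : ENNReal} (ha : a ≠ ⊤) (f : ℝ → ENNReal) (s : ℝ) :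
    laplaceTransform (fun t => a * f t) s = a * laplaceTransform f s := by
  simp only [laplaceTransform, mul_left_comm _ a]
  exact lintegral_const_mul' a _ ha

lemma laplaceTransform_tsum {f : ℕ → ℝ → ENNReal} (hf : ∀ k, Measurable (f k)) (s : ℝ) :
    laplaceTransform (fun t => ∑' k, f k t) s = ∑' k, laplaceTransform (f k) s := by
  simp only [laplaceTransform, ← ENNReal.tsum_mul_left]
  exact lintegral_tsum fun k => by fun_prop

lemma laplaceTransform_lintegral {β : Type*} [MeasurableSpace β] {ν : Measure β} [SFinite ν]
    {f : ℝ → β → ENNReal} (hf : Measurable (Function.uncurry f)) (s : ℝ) :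
    laplaceTransform (fun t => ∫⁻ z, f t z ∂ν) s =
      ∫⁻ z, laplaceTransform (fun t => f t z) s ∂ν := by
  simp only [laplaceTransform, ← lintegral_const_mul' _ _ ENNReal.ofReal_ne_top]
  exact lintegral_lintegral_swap (by fun_prop)

lemma laplaceTransform_indicator_Ici {x s : ℝ} (hx : 0 ≤ x) (hs : 0 < s) :
    laplaceTransform ((Ici x).indicator 1) s = ENNReal.ofReal (Real.exp (-(s * x)) / s) := by
  have hset : (Ici x ∩ Ioi 0 : Set ℝ) =ᵐ[volume] Ioi x := by
    have h : (Ici x ∩ Ioi 0 : Set ℝ) =ᵐ[volume] (Ioi x ∩ Ioi 0 : Set ℝ) :=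
      Ioi_ae_eq_Ici.symm.inter (ae_eq_refl _)
    rwa [inter_eq_left.2 (Ioi_subset_Ioi hx)] at h
  have hindicator (t : ℝ) : ENNReal.ofReal (Real.exp (-(s * t))) * (Ici x).indicator 1 t =
      (Ici x).indicator (fun t => ENNReal.ofReal (Real.exp (-s * t))) t := by
    simp [indicator_apply]
  simp only [laplaceTransform, hindicator]
  rw [setLIntegral_indicator measurableSet_Ici, setLIntegral_congr hset,
    ← ofReal_integral_eq_lintegral_ofReal (integrableOn_exp_mul_Ioi (by linarith) x)
      (ae_of_all _ fun _ => Real.exp_nonneg _),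
    integral_exp_mul_Ioi (by linarith), neg_div_neg_eq, neg_mul]

lemma laplaceTransform_cdf {μ : Measure ℝ} [IsFiniteMeasure μ] (hμ : ∀ᵐ x ∂μ, 0 ≤ x) {s : ℝ}
    (hs : 0 < s) :
    laplaceTransform (fun t => μ (Iic t)) s = ENNReal.ofReal (mgf id μ (-s) / s) := by
  have hcdf (t : ℝ) : μ (Iic t) = ∫⁻ x, (Ici x).indicator 1 t ∂μ := by
    rw [← lintegral_indicator_one measurableSet_Iic]
    simp [indicator_apply]
  have hmeas : Measurable (Function.uncurry fun t x : ℝ => (Ici x).indicator (1 : ℝ → ENNReal) t) :=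
    Measurable.indicator measurable_const
      (measurableSet_le (measurable_snd (α := ℝ) (β := ℝ)) measurable_fst)
  have hint : Integrable (fun x => Real.exp (-(s * x))) μ := by
    simpa using integrable_exp_neg_mul (f := id) aemeasurable_id hμ hs.le
  simp only [hcdf, laplaceTransform_lintegral hmeas]
  rw [lintegral_congr_ae (hμ.mono fun x hx => laplaceTransform_indicator_Ici hx hs),
    ← ofReal_integral_eq_lintegral_ofReal (hint.div_const s)
      (ae_of_all _ fun x => by positivity), integral_div]
  simp [mgf]

/-- Tilting by `e^{-t}` makes the measures with densities `f` and `g` finite. -/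
lemma ae_eq_of_laplaceTransform_natCast_succ_eq {f g : ℝ → ENNReal} (hf : Measurable f)
    (hg : Measurable g) (hfin : laplaceTransform f 1 ≠ ⊤)
    (h : ∀ n : ℕ, laplaceTransform f (n + 1) = laplaceTransform g (n + 1)) :
    f =ᵐ[volume.restrict (Ioi (0 : ℝ))] g := by
  let tilted (F : ℝ → ENNReal) : ℝ → ENNReal :=
    fun t => ENNReal.ofReal (Real.exp (-(1 * t))) * F t
  let M (F : ℝ → ENNReal) : Measure ℝ := (volume.restrict (Ioi (0 : ℝ))).withDensity (tilted F)
  have htilted {F : ℝ → ENNReal} (hF : Measurable F) : Measurable (tilted F) := by fun_prop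
  have hnonneg (F : ℝ → ENNReal) : ∀ᵐ t ∂M F, 0 ≤ t :=
    (withDensity_absolutelyContinuous _ _).ae_le
      ((ae_restrict_mem measurableSet_Ioi).mono fun t ht => le_of_lt ht)
  have hmgf {F : ℝ → ENNReal} (hF : Measurable F) (n : ℕ) :
      mgf id (M F) (-n) = (laplaceTransform F (n + 1)).toReal := by
    rw [mgf, integral_eq_lintegral_of_nonneg_ae (ae_of_all _ fun x => Real.exp_nonneg _)
      (by fun_prop), lintegral_withDensity_eq_lintegral_mul _ (htilted hF) (by fun_prop)]
    congr 1
    refine lintegral_congr fun t => ?_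
    rw [Pi.mul_apply, mul_right_comm, ← ENNReal.ofReal_mul (Real.exp_nonneg _), ← Real.exp_add]
    congr 3
    simp only [id_eq]
    ring
  have : IsFiniteMeasure (M f) := isFiniteMeasure_withDensity hfin
  have : IsFiniteMeasure (M g) :=
    isFiniteMeasure_withDensity (by have h0 := h 0; simp_all [laplaceTransform, tilted])
  have hM : M f = M g := measure_ext_of_mgf_neg_natCast (hnonneg f) (hnonneg g) fun n => by
    rw [hmgf hf, hmgf hg, h]
  filter_upwards [(withDensity_eq_iff (htilted hf).aemeasurable (htilted hg).aemeasurable hfin).1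
    hM] with t ht
  exact (ENNReal.mul_right_inj (by simp [Real.exp_pos]) ENNReal.ofReal_ne_top).1 ht

end LaplaceTransform

section GaussianKernels

lemma lintegral_Ioi_of_hasDerivAt_of_tendsto {g g' : ℝ → ℝ} {a l₀ l₁ : ℝ}
    (hg₀ : Tendsto g (𝓝[>] a) (𝓝 l₀)) (hderiv : ∀ t ∈ Ioi a, HasDerivAt g (g' t) t)
    (hnonneg : ∀ t ∈ Ioi a, 0 ≤ g' t) (hg₁ : Tendsto g atTop (𝓝 l₁)) :
    ∫⁻ t in Ioi a, ENNReal.ofReal (g' t) = ENNReal.ofReal (l₁ - l₀) := by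
  let G : ℝ → ℝ := Function.update g a l₀
  have hGg : ∀ t ∈ Ioi a, G =ᶠ[𝓝 t] g := fun t ht => by
    filter_upwards [Ioi_mem_nhds (mem_Ioi.1 ht)] with x hx
    exact Function.update_of_ne hx.ne' _ _
  have hGcont : ContinuousWithinAt G (Ici a) a := by
    rwa [continuousWithinAt_update_same, Ici_sdiff_left]
  have hGderiv : ∀ t ∈ Ioi a, HasDerivAt G (g' t) t := fun t ht =>
    (hderiv t ht).congr_of_eventuallyEq (hGg t ht)
  have hGlim : Tendsto G atTop (𝓝 l₁) := by
    refine hg₁.congr' ?_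
    filter_upwards [eventually_gt_atTop a] with t ht using (hGg t ht).symm.eq_of_nhds
  rw [← ofReal_integral_eq_lintegral_ofReal
      (integrableOn_Ioi_deriv_of_nonneg hGcont hGderiv hnonneg hGlim)
      ((ae_restrict_mem measurableSet_Ioi).mono hnonneg),
    integral_Ioi_of_hasDerivAt_of_nonneg hGcont hGderiv hnonneg hGlim,
    show G a = l₀ from Function.update_self ..]

/-- An error function: the primitive of `e^{-u²/2}` that vanishes at zero. -/
noncomputable def gaussPrimitive (x : ℝ) : ℝ := ∫ u in (0 : ℝ)..x, Real.exp (-(1 / 2) * u ^ 2)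

lemma hasDerivAt_gaussPrimitive (x : ℝ) :
    HasDerivAt gaussPrimitive (Real.exp (-(1 / 2) * x ^ 2)) x :=
  (Continuous.integral_hasStrictDerivAt (by fun_prop) 0 x).hasDerivAt

lemma gaussPrimitive_neg (x : ℝ) : gaussPrimitive (-x) = -gaussPrimitive x := by
  have h := intervalIntegral.integral_comp_neg (a := 0) (b := x)
    (fun u => Real.exp (-(1 / 2) * u ^ 2))
  simp only [neg_sq, neg_zero] at h
  rw [gaussPrimitive, gaussPrimitive, h, intervalIntegral.integral_symm]

lemma tendsto_gaussPrimitive_atTop :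
    Tendsto gaussPrimitive atTop (𝓝 (√(2 * Real.pi) / 2)) := by
  have h := intervalIntegral_tendsto_integral_Ioi (0 : ℝ)
    (integrable_exp_neg_mul_sq (b := 1 / 2) (by norm_num)).integrableOn tendsto_id
  rwa [integral_gaussian_Ioi, div_div_eq_mul_div, div_one, mul_comm] at h

lemma tendsto_gaussPrimitive_atBot :
    Tendsto gaussPrimitive atBot (𝓝 (-(√(2 * Real.pi) / 2))) := by
  refine (tendsto_gaussPrimitive_atTop.comp tendsto_neg_atBot_atTop).neg.congr fun x => ?_
  simp [gaussPrimitive_neg]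

/-- The Gaussian heat kernel `t^{-1/2} e^{-x²/(2t)}`, without its normalization `(2π)^{-1/2}`. -/
noncomputable def gaussKernel (x t : ℝ) : ℝ := (√t)⁻¹ * Real.exp (-(x ^ 2 / (2 * t)))

lemma gaussKernel_nonneg (x t : ℝ) : 0 ≤ gaussKernel x t := by
  unfold gaussKernel
  positivity

/-- A primitive in `t` of `e^{-θ²t/2} gaussKernel x t`. -/
noncomputable def gaussKernelPrimitive (x θ t : ℝ) : ℝ :=
  θ⁻¹ * (Real.exp (-(x * θ)) * gaussPrimitive (θ * √t - x / √t) +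
    Real.exp (x * θ) * gaussPrimitive (θ * √t + x / √t))

lemma hasDerivAt_gaussKernelPrimitive (x : ℝ) {θ t : ℝ} (hθ : θ ≠ 0) (ht : 0 < t) :
    HasDerivAt (gaussKernelPrimitive x θ) (Real.exp (-(θ ^ 2 / 2 * t)) * gaussKernel x t) t := by
  have hst : 0 < √t := Real.sqrt_pos.2 ht
  have hsq : √t ^ 2 = t := Real.sq_sqrt ht.le
  have hsqrt : HasDerivAt (fun t : ℝ => √t) (1 / (2 * √t)) t := Real.hasDerivAt_sqrt ht.ne'
  have hdiv : HasDerivAt (fun t : ℝ => x / √t) (-(x * (1 / (2 * √t))) / √t ^ 2) t :=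
    ((hasDerivAt_const t x).div hsqrt hst.ne').congr_deriv (by rw [zero_mul, zero_sub])
  have hsub := (hasDerivAt_gaussPrimitive _).comp t ((hsqrt.const_mul θ).sub hdiv)
  have hadd := (hasDerivAt_gaussPrimitive _).comp t ((hsqrt.const_mul θ).add hdiv)
  refine (((hsub.const_mul (Real.exp (-(x * θ)))).add
    (hadd.const_mul (Real.exp (x * θ)))).const_mul θ⁻¹).congr_deriv ?_
  have hsplit : Real.exp (-(θ ^ 2 / 2 * t)) * gaussKernel x t =
      (√t)⁻¹ * Real.exp (-(θ ^ 2 / 2 * √t ^ 2) - x ^ 2 / (2 * √t ^ 2)) := by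
    rw [gaussKernel, mul_left_comm, ← Real.exp_add, hsq, sub_eq_add_neg]
  have hexp_sub : Real.exp (-(x * θ)) * Real.exp (-(1 / 2) * (θ * √t - x / √t) ^ 2) =
      Real.exp (-(θ ^ 2 / 2 * √t ^ 2) - x ^ 2 / (2 * √t ^ 2)) := by
    rw [← Real.exp_add]
    congr 1
    field_simp
    ring
  have hexp_add : Real.exp (x * θ) * Real.exp (-(1 / 2) * (θ * √t + x / √t) ^ 2) =
      Real.exp (-(θ ^ 2 / 2 * √t ^ 2) - x ^ 2 / (2 * √t ^ 2)) := by
    rw [← Real.exp_add]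
    congr 1
    field_simp
    ring
  rw [← mul_assoc, ← mul_assoc, Pi.sub_apply, Pi.add_apply, hexp_sub, hexp_add, hsplit]
  field_simp
  ring

lemma tendsto_gaussKernelPrimitive_nhdsGT_zero {x : ℝ} (hx : 0 < x) (θ : ℝ) :
    Tendsto (gaussKernelPrimitive x θ) (𝓝[>] 0)
      (𝓝 (θ⁻¹ * (Real.exp (-(x * θ)) * -(√(2 * Real.pi) / 2) +
        Real.exp (x * θ) * (√(2 * Real.pi) / 2)))) := by
  have hsqrt : Tendsto (fun t : ℝ => √t) (𝓝[>] 0) (𝓝[>] 0) := by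
    refine tendsto_nhdsWithin_iff.2 ⟨?_, ?_⟩
    · exact tendsto_nhdsWithin_of_tendsto_nhds (Real.continuous_sqrt.tendsto' 0 0 Real.sqrt_zero)
    · filter_upwards [self_mem_nhdsWithin] with t ht using Real.sqrt_pos.2 ht
  have hmul : Tendsto (fun t : ℝ => θ * √t) (𝓝[>] 0) (𝓝 0) := by
    simpa using (hsqrt.mono_right nhdsWithin_le_nhds).const_mul θ
  have hdiv : Tendsto (fun t : ℝ => x / √t) (𝓝[>] 0) atTop :=
    (tendsto_inv_nhdsGT_zero.comp hsqrt).const_mul_atTop hx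
  have hsub : Tendsto (fun t : ℝ => θ * √t - x / √t) (𝓝[>] 0) atBot := by
    simpa only [sub_eq_add_neg, Function.comp_def] using
      hmul.add_atBot (tendsto_neg_atTop_atBot.comp hdiv)
  exact (((tendsto_gaussPrimitive_atBot.comp hsub).const_mul _).add
    ((tendsto_gaussPrimitive_atTop.comp (hmul.add_atTop hdiv)).const_mul _)).const_mul _

lemma tendsto_gaussKernelPrimitive_atTop (x : ℝ) {θ : ℝ} (hθ : 0 < θ) :
    Tendsto (gaussKernelPrimitive x θ) atTop
      (𝓝 (θ⁻¹ * (Real.exp (-(x * θ)) * (√(2 * Real.pi) / 2) +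
        Real.exp (x * θ) * (√(2 * Real.pi) / 2)))) := by
  have hmul : Tendsto (fun t : ℝ => θ * √t) atTop atTop :=
    Real.tendsto_sqrt_atTop.const_mul_atTop hθ
  have hdiv : Tendsto (fun t : ℝ => x / √t) atTop (𝓝 0) :=
    Real.tendsto_sqrt_atTop.const_div_atTop x
  have hsub : Tendsto (fun t : ℝ => θ * √t - x / √t) atTop atTop := by
    simpa only [sub_eq_add_neg] using hmul.atTop_add hdiv.neg
  exact (((tendsto_gaussPrimitive_atTop.comp hsub).const_mul _).add
    ((tendsto_gaussPrimitive_atTop.comp (hmul.atTop_add hdiv)).const_mul _)).const_mul _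

lemma laplaceTransform_gaussKernel {x θ : ℝ} (hx : 0 < x) (hθ : 0 < θ) :
    laplaceTransform (fun t => ENNReal.ofReal (gaussKernel x t)) (θ ^ 2 / 2) =
      ENNReal.ofReal (√(2 * Real.pi) / θ * Real.exp (-(x * θ))) := by
  simp only [laplaceTransform, ← ENNReal.ofReal_mul (Real.exp_nonneg _)]
  rw [lintegral_Ioi_of_hasDerivAt_of_tendsto (tendsto_gaussKernelPrimitive_nhdsGT_zero hx θ)
    (fun t ht => hasDerivAt_gaussKernelPrimitive x hθ.ne' ht)
    (fun t _ => mul_nonneg (Real.exp_nonneg _) (gaussKernel_nonneg x t))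
    (tendsto_gaussKernelPrimitive_atTop x hθ)]
  congr 1
  ring

lemma lintegral_rpow_mul_exp_neg_mul {a r : ℝ} (ha : -1 < a) (hr : 0 < r) :
    ∫⁻ z in Ioi (0 : ℝ), ENNReal.ofReal (z ^ a * Real.exp (-(r * z))) =
      ENNReal.ofReal ((1 / r) ^ (a + 1) * Real.Gamma (a + 1)) := by
  have hint : IntegrableOn (fun z : ℝ => z ^ a * Real.exp (-(r * z))) (Ioi 0) := by
    simpa [neg_mul] using integrableOn_rpow_mul_exp_neg_mul_rpow (p := 1) ha one_pos hr
  rw [← Real.integral_rpow_mul_exp_neg_mul_Ioi (by linarith) hr, add_sub_cancel_right,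
    ofReal_integral_eq_lintegral_ofReal hint]
  filter_upwards [ae_restrict_mem measurableSet_Ioi] with z hz
  have : 0 < z := hz
  positivity

lemma lintegral_rpow_neg_half_mul_exp_neg_mul {r : ℝ} (hr : 0 < r) :
    ∫⁻ z in Ioi (0 : ℝ), ENNReal.ofReal (z ^ (-(1 / 2) : ℝ) * Real.exp (-(r * z))) =
      ENNReal.ofReal √(Real.pi / r) := by
  rw [lintegral_rpow_mul_exp_neg_mul (by norm_num) hr,
    show (-(1 / 2) + 1 : ℝ) = 1 / 2 by norm_num, Real.Gamma_one_half_eq, ← Real.sqrt_eq_rpow,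
    ← Real.sqrt_mul (by positivity), one_div_mul_eq_div]

lemma lintegral_rpow_three_halves_mul_exp_neg_mul {r : ℝ} (hr : 0 < r) :
    ∫⁻ z in Ioi (0 : ℝ), ENNReal.ofReal (z ^ (3 / 2 : ℝ) * Real.exp (-(r * z))) =
      ENNReal.ofReal (√(Real.pi / r) * (3 / (4 * r ^ 2))) := by
  have hGamma : Real.Gamma (3 / 2 + 1) = 3 / 4 * √Real.pi := by
    rw [Real.Gamma_add_one (by norm_num), show (3 / 2 : ℝ) = 1 / 2 + 1 by norm_num,
      Real.Gamma_add_one (by norm_num), Real.Gamma_one_half_eq]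
    ring
  have hpow : (1 / r) ^ (3 / 2 + 1 : ℝ) = √(1 / r) * (1 / r) ^ 2 := by
    rw [Real.sqrt_eq_rpow, ← Real.rpow_natCast, ← Real.rpow_add (by positivity)]
    norm_num
  rw [lintegral_rpow_mul_exp_neg_mul (by norm_num) hr, hGamma, hpow, ← one_div_mul_eq_div r Real.pi,
    Real.sqrt_mul (by positivity)]
  congr 1
  ring

/-- The half-order integral in `x` of the Gaussian kernel over `[b, ∞)`. It is chosen so that its
Laplace transform at `θ²/2` is proportional to `θ^{-3/2} e^{-bθ}`. -/
noncomputable def abelGaussKernel (b t : ℝ) : ENNReal :=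
  ∫⁻ z in Ioi (0 : ℝ), ENNReal.ofReal (z ^ (-(1 / 2) : ℝ)) * ENNReal.ofReal (gaussKernel (b + z) t)

lemma measurable_abelGaussKernel_integrand (b : ℝ) :
    Measurable (Function.uncurry fun t z : ℝ =>
      ENNReal.ofReal (z ^ (-(1 / 2) : ℝ)) * ENNReal.ofReal (gaussKernel (b + z) t)) := by
  unfold gaussKernel Function.uncurry
  fun_prop

lemma measurable_abelGaussKernel (b : ℝ) : Measurable (abelGaussKernel b) :=
  (measurable_abelGaussKernel_integrand b).lintegral_prod_right'

lemma laplaceTransform_abelGaussKernel {b θ : ℝ} (hb : 0 < b) (hθ : 0 < θ) :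
    laplaceTransform (abelGaussKernel b) (θ ^ 2 / 2) =
      ENNReal.ofReal (√2 * Real.pi / (θ * √θ) * Real.exp (-(b * θ))) := by
  have hinner : ∀ z ∈ Ioi (0 : ℝ), laplaceTransform (fun t =>
        ENNReal.ofReal (z ^ (-(1 / 2) : ℝ)) * ENNReal.ofReal (gaussKernel (b + z) t)) (θ ^ 2 / 2) =
      ENNReal.ofReal (√(2 * Real.pi) / θ * Real.exp (-(b * θ))) *
        ENNReal.ofReal (z ^ (-(1 / 2) : ℝ) * Real.exp (-(θ * z))) := fun z hz => by
    have : 0 < z := hz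
    rw [laplaceTransform_const_mul ENNReal.ofReal_ne_top,
      laplaceTransform_gaussKernel (by positivity) hθ, ← ENNReal.ofReal_mul (by positivity),
      ← ENNReal.ofReal_mul (by positivity), add_mul, neg_add, Real.exp_add, mul_comm z θ]
    congr 1
    ring
  unfold abelGaussKernel
  rw [laplaceTransform_lintegral (measurable_abelGaussKernel_integrand b),
    setLIntegral_congr_fun measurableSet_Ioi hinner, lintegral_const_mul _ (by fun_prop),
    lintegral_rpow_neg_half_mul_exp_neg_mul hθ, ← ENNReal.ofReal_mul (by positivity),
    Real.sqrt_mul zero_le_two, Real.sqrt_div Real.pi_pos.le]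
  congr 1
  have hpi : √Real.pi ^ 2 = Real.pi := Real.sq_sqrt Real.pi_pos.le
  field_simp
  linear_combination hpi

lemma gaussKernel_add (b z : ℝ) {t : ℝ} (ht : t ≠ 0) :
    gaussKernel (b + z) t =
      gaussKernel b t * Real.exp (-(b / t * z)) * Real.exp (-(z ^ 2 / (2 * t))) := by
  rw [gaussKernel, gaussKernel, mul_assoc, mul_assoc, ← Real.exp_add, ← Real.exp_add]
  congr 2
  field_simp
  ring

lemma gaussKernel_add_le (b z : ℝ) {t : ℝ} (ht : 0 < t) :
    gaussKernel (b + z) t ≤ gaussKernel b t * Real.exp (-(b / t * z)) := by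
  rw [gaussKernel_add b z ht.ne']
  refine mul_le_of_le_one_right (mul_nonneg (gaussKernel_nonneg b t) (Real.exp_nonneg _)) ?_
  rw [Real.exp_le_one_iff, neg_nonpos]
  positivity

lemma le_gaussKernel_add (b z : ℝ) {t : ℝ} (ht : t ≠ 0) :
    gaussKernel b t * Real.exp (-(b / t * z)) * (1 - z ^ 2 / (2 * t)) ≤ gaussKernel (b + z) t := by
  rw [gaussKernel_add b z ht]
  exact mul_le_mul_of_nonneg_left (Real.one_sub_le_exp_neg _)
    (mul_nonneg (gaussKernel_nonneg b t) (Real.exp_nonneg _))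

lemma gaussKernel_mul_sqrt {b t : ℝ} (hb : 0 < b) (ht : 0 < t) :
    gaussKernel b t * √(Real.pi / (b / t)) =
      √(Real.pi / b) * Real.exp (-(b ^ 2 / (2 * t))) := by
  rw [gaussKernel, div_div_eq_mul_div, mul_div_right_comm, Real.sqrt_mul (by positivity)]
  have : 0 < √t := Real.sqrt_pos.2 ht
  field_simp

lemma abelGaussKernel_le {b t : ℝ} (hb : 0 < b) (ht : 0 < t) :
    abelGaussKernel b t ≤
      ENNReal.ofReal (√(Real.pi / b) * Real.exp (-(b ^ 2 / (2 * t)))) := by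
  have hkernel := gaussKernel_nonneg b t
  have hle : ∀ z ∈ Ioi (0 : ℝ),
      ENNReal.ofReal (z ^ (-(1 / 2) : ℝ)) * ENNReal.ofReal (gaussKernel (b + z) t) ≤
        ENNReal.ofReal (gaussKernel b t) *
          ENNReal.ofReal (z ^ (-(1 / 2) : ℝ) * Real.exp (-(b / t * z))) := fun z hz => by
    have hz' : 0 < z := hz
    rw [← ENNReal.ofReal_mul (by positivity), ← ENNReal.ofReal_mul hkernel, mul_left_comm]
    gcongr
    exact gaussKernel_add_le b z ht
  calc abelGaussKernel b t
      ≤ ∫⁻ z in Ioi (0 : ℝ), ENNReal.ofReal (gaussKernel b t) *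
          ENNReal.ofReal (z ^ (-(1 / 2) : ℝ) * Real.exp (-(b / t * z))) :=
        setLIntegral_mono' measurableSet_Ioi hle
    _ = _ := by
        rw [lintegral_const_mul _ (by fun_prop), lintegral_rpow_neg_half_mul_exp_neg_mul
          (by positivity), ← ENNReal.ofReal_mul hkernel, gaussKernel_mul_sqrt hb ht]

lemma le_abelGaussKernel {b t : ℝ} (hb : 0 < b) (ht : 0 < t) :
    ENNReal.ofReal (√(Real.pi / b) * Real.exp (-(b ^ 2 / (2 * t))) *
      (1 - 3 * t / (8 * b ^ 2))) ≤ abelGaussKernel b t := by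
  have hkernel := gaussKernel_nonneg b t
  have hle : ∀ z ∈ Ioi (0 : ℝ),
      ENNReal.ofReal (gaussKernel b t) *
          ENNReal.ofReal (z ^ (-(1 / 2) : ℝ) * Real.exp (-(b / t * z))) ≤
        ENNReal.ofReal (z ^ (-(1 / 2) : ℝ)) * ENNReal.ofReal (gaussKernel (b + z) t) +
          ENNReal.ofReal (gaussKernel b t * (1 / (2 * t))) *
            ENNReal.ofReal (z ^ (3 / 2 : ℝ) * Real.exp (-(b / t * z))) := fun z hz => by
    have hz' : 0 < z := hz
    have hpow : z ^ (3 / 2 : ℝ) = z ^ (-(1 / 2) : ℝ) * z ^ 2 := by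
      rw [← Real.rpow_natCast z 2, ← Real.rpow_add hz']
      norm_num
    rw [← ENNReal.ofReal_mul hkernel, ← ENNReal.ofReal_mul (by positivity),
      ← ENNReal.ofReal_mul (by positivity),
      ← ENNReal.ofReal_add (mul_nonneg (by positivity) (gaussKernel_nonneg _ _)) (by positivity),
      hpow]
    refine ENNReal.ofReal_le_ofReal ?_
    have hmul := mul_le_mul_of_nonneg_left (le_gaussKernel_add b z ht.ne')
      (by positivity : 0 ≤ z ^ (-(1 / 2) : ℝ))
    rw [div_eq_mul_one_div (z ^ 2)] at hmul
    linarith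
  have hint := setLIntegral_mono' (μ := volume) measurableSet_Ioi hle
  rw [lintegral_add_right _ (by fun_prop), lintegral_const_mul _ (by fun_prop),
    lintegral_const_mul _ (by fun_prop), lintegral_rpow_neg_half_mul_exp_neg_mul (by positivity),
    lintegral_rpow_three_halves_mul_exp_neg_mul (by positivity), ← ENNReal.ofReal_mul hkernel,
    ← ENNReal.ofReal_mul (by positivity), gaussKernel_mul_sqrt hb ht, mul_mul_mul_comm,
    gaussKernel_mul_sqrt hb ht] at hint
  rw [mul_one_sub, ENNReal.ofReal_sub _ (by positivity), tsub_le_iff_right]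
  have hcoeff : 3 * t / (8 * b ^ 2) = 1 / (2 * t) * (3 / (4 * (b / t) ^ 2)) := by
    field_simp
    norm_num
  rwa [hcoeff]

end GaussianKernels

section SmallBallAsymptotics

/-- The `k`-th Taylor coefficient `(k - 1/2 choose k)` of `(1 - q)^{-1/2}` at `q = 0`. -/
noncomputable def invSqrtCoeff (k : ℕ) : ℝ := Ring.choose ((1 / 2 : ℝ) + k - 1) k

lemma invSqrtCoeff_zero : invSqrtCoeff 0 = 1 := by
  simp [invSqrtCoeff]

lemma invSqrtCoeff_nonneg (k : ℕ) : 0 ≤ invSqrtCoeff k := by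
  have hpoch : 0 ≤ (k.factorial : ℝ) * invSqrtCoeff k := by
    rw [invSqrtCoeff, ← nsmul_eq_mul, ← Ring.descPochhammer_eq_factorial_smul_choose,
      Polynomial.descPochhammer_smeval_eq_ascPochhammer, Polynomial.ascPochhammer_smeval_eq_eval]
    exact (ascPochhammer_pos k _ (by linarith)).le
  exact nonneg_of_mul_nonneg_right hpoch (by positivity)

lemma hasSum_invSqrtCoeff {q : ℝ} (h0 : 0 ≤ q) (h1 : q < 1) :
    HasSum (fun k => invSqrtCoeff k * q ^ k) (√(1 - q))⁻¹ := by
  have h := (Real.one_div_one_sub_rpow_hasFPowerSeriesOnBall_zero (1 / 2)).hasSum (y := q)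
    (by simp [enorm_eq_nnnorm, ← NNReal.coe_lt_coe, abs_of_nonneg h0, h1])
  simp only [FormalMultilinearSeries.ofScalars_apply_eq, zero_add, smul_eq_mul] at h
  rwa [Real.sqrt_eq_rpow, ← one_div]

lemma sqrt_div_sinh_eq {θ : ℝ} (hθ : 0 < θ) :
    √(θ / Real.sinh θ) =
      √2 * √θ * Real.exp (-(1 / 2 * θ)) * (√(1 - Real.exp (-(2 * θ))))⁻¹ := by
  have hq : 0 < 1 - Real.exp (-(2 * θ)) := sub_pos.2 (Real.exp_lt_one_iff.2 (by linarith))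
  have hdiv : θ / Real.sinh θ = 2 * θ * Real.exp (-θ) / (1 - Real.exp (-(2 * θ))) := by
    have hexp : Real.exp (-(2 * θ)) = Real.exp (-θ) * Real.exp (-θ) := by
      rw [← Real.exp_add]
      ring_nf
    have hinv : Real.exp (-θ) * Real.exp θ = 1 := by
      rw [← Real.exp_add, neg_add_cancel, Real.exp_zero]
    rw [div_eq_div_iff (Real.sinh_pos_iff.2 hθ).ne' hq.ne', hexp, Real.sinh_eq]
    linear_combination -θ * hinv
  rw [hdiv, Real.sqrt_div (by positivity), Real.sqrt_mul (by positivity),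
    Real.sqrt_mul zero_le_two, ← Real.exp_half, div_eq_mul_inv]
  ring_nf

lemma hasSum_sqrt_div_sinh {θ : ℝ} (hθ : 0 < θ) :
    HasSum (fun k : ℕ => invSqrtCoeff k * (√2 * √θ * Real.exp (-((2 * k + 1 / 2) * θ))))
      √(θ / Real.sinh θ) := by
  rw [sqrt_div_sinh_eq hθ]
  refine ((hasSum_invSqrtCoeff (Real.exp_nonneg (-(2 * θ)))
    (Real.exp_lt_one_iff.2 (by linarith))).mul_left _).congr_fun fun k => ?_
  have hexp : Real.exp (-((2 * k + 1 / 2) * θ)) =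
      Real.exp (-(1 / 2 * θ)) * Real.exp (-(2 * θ)) ^ k := by
    rw [← Real.exp_nat_mul, ← Real.exp_add]
    ring_nf
  rw [hexp]
  ring

/-- The distribution function whose Laplace transform at `θ²/2` is `√(θ / sinh θ)` divided by
`θ²/2`, obtained by inverting the expansion `hasSum_sqrt_div_sinh` term by term. -/
noncomputable def sinhCdf (t : ℝ) : ENNReal :=
  ∑' k : ℕ, ENNReal.ofReal (2 / Real.pi * invSqrtCoeff k) * abelGaussKernel (2 * k + 1 / 2) t

lemma measurable_sinhCdf : Measurable sinhCdf :=
  Measurable.tsum fun _ => (measurable_abelGaussKernel _).const_mul _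

lemma laplaceTransform_sinhCdf {θ : ℝ} (hθ : 0 < θ) :
    laplaceTransform sinhCdf (θ ^ 2 / 2) =
      ENNReal.ofReal (√(θ / Real.sinh θ) / (θ ^ 2 / 2)) := by
  have hterm (k : ℕ) :
      laplaceTransform (fun t => ENNReal.ofReal (2 / Real.pi * invSqrtCoeff k) *
        abelGaussKernel (2 * k + 1 / 2) t) (θ ^ 2 / 2) =
      ENNReal.ofReal (invSqrtCoeff k * (√2 * √θ * Real.exp (-((2 * k + 1 / 2) * θ))) /
        (θ ^ 2 / 2)) := by
    have := invSqrtCoeff_nonneg k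
    have hsq : √θ ^ 2 = θ := Real.sq_sqrt hθ.le
    rw [laplaceTransform_const_mul ENNReal.ofReal_ne_top,
      laplaceTransform_abelGaussKernel (by positivity) hθ, ← ENNReal.ofReal_mul (by positivity)]
    congr 1
    field_simp
    linear_combination -(invSqrtCoeff k) * hsq
  have hsum := (hasSum_sqrt_div_sinh hθ).div_const (θ ^ 2 / 2)
  unfold sinhCdf
  rw [laplaceTransform_tsum fun k => (measurable_abelGaussKernel _).const_mul _]
  simp only [hterm]
  rw [← ENNReal.ofReal_tsum_of_nonneg _ hsum.summable, hsum.tsum_eq]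
  intro k
  have := invSqrtCoeff_nonneg k
  positivity

lemma two_div_pi_mul_sqrt : 2 / Real.pi * √(Real.pi / (1 / 2)) = √(8 / Real.pi) := by
  have := Real.pi_pos
  rw [eq_comm, Real.sqrt_eq_iff_eq_sq (by positivity) (by positivity), mul_pow,
    Real.sq_sqrt (by positivity)]
  field_simp
  norm_num

lemma sinhCdf_le {t : ℝ} (ht : 0 < t) :
    sinhCdf t ≤ ENNReal.ofReal (√(8 / Real.pi) * Real.exp (-(1 / (8 * t))) *
      (√(1 - Real.exp (-(1 / t))))⁻¹) := by
  have hsum := (hasSum_invSqrtCoeff (Real.exp_nonneg (-(1 / t)))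
    (Real.exp_lt_one_iff.2 (by simp [ht]))).mul_left
      (√(8 / Real.pi) * Real.exp (-(1 / (8 * t))))
  have hcoeff := invSqrtCoeff_nonneg
  rw [← hsum.tsum_eq, ENNReal.ofReal_tsum_of_nonneg
    (fun k => mul_nonneg (by positivity) (mul_nonneg (hcoeff k) (by positivity))) hsum.summable]
  refine ENNReal.tsum_le_tsum fun k => ?_
  have hexp : Real.exp (-((2 * k + 1 / 2) ^ 2 / (2 * t))) ≤
      Real.exp (-(1 / (8 * t))) * Real.exp (-(1 / t)) ^ k := by
    rw [← Real.exp_nat_mul, ← Real.exp_add, Real.exp_le_exp, ← sub_nonneg]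
    have : -(1 / (8 * t)) + k * -(1 / t) - -((2 * k + 1 / 2) ^ 2 / (2 * t)) =
        2 * (k : ℝ) ^ 2 / t := by
      field_simp
      ring
    rw [this]
    positivity
  have hsqrt : √(Real.pi / (2 * k + 1 / 2)) ≤ √(Real.pi / (1 / 2)) := by
    gcongr
    linarith [k.cast_nonneg (α := ℝ)]
  have hk := hcoeff k
  calc ENNReal.ofReal (2 / Real.pi * invSqrtCoeff k) * abelGaussKernel (2 * k + 1 / 2) t
      ≤ ENNReal.ofReal (2 / Real.pi * invSqrtCoeff k) * ENNReal.ofReal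
          (√(Real.pi / (1 / 2)) * (Real.exp (-(1 / (8 * t))) * Real.exp (-(1 / t)) ^ k)) := by
        gcongr
        exact (abelGaussKernel_le (by positivity) ht).trans (by gcongr)
    _ = _ := by
        rw [← ENNReal.ofReal_mul (by positivity), ← two_div_pi_mul_sqrt]
        ring_nf

lemma le_sinhCdf {t : ℝ} (ht : 0 < t) :
    ENNReal.ofReal (√(8 / Real.pi) * Real.exp (-(1 / (8 * t))) * (1 - 3 / 2 * t)) ≤
      sinhCdf t := by
  calc ENNReal.ofReal (√(8 / Real.pi) * Real.exp (-(1 / (8 * t))) * (1 - 3 / 2 * t))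
      = ENNReal.ofReal (2 / Real.pi) * ENNReal.ofReal (√(Real.pi / (1 / 2)) *
          Real.exp (-((1 / 2) ^ 2 / (2 * t))) * (1 - 3 * t / (8 * (1 / 2) ^ 2))) := by
        rw [← ENNReal.ofReal_mul (by positivity), ← two_div_pi_mul_sqrt]
        ring_nf
    _ ≤ ENNReal.ofReal (2 / Real.pi) * abelGaussKernel (1 / 2) t := by
        gcongr
        exact le_abelGaussKernel one_half_pos ht
    _ ≤ sinhCdf t := by
        simpa [sinhCdf, invSqrtCoeff_zero] using ENNReal.le_tsum (f := fun k : ℕ =>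
          ENNReal.ofReal (2 / Real.pi * invSqrtCoeff k) * abelGaussKernel (2 * k + 1 / 2) t) 0

lemma frequently_nhdsLT_of_ae {p : ℝ → Prop} (h : ∀ᵐ x, p x) (t : ℝ) : ∃ᶠ x in 𝓝[<] t, p x := by
  intro hnot
  obtain ⟨a, hat, hsub⟩ := mem_nhdsLT_iff_exists_Ioo_subset.1 hnot
  obtain ⟨x, hpx, hx⟩ := (Measure.dense_of_ae h).exists_between hat
  exact hsub hx hpx

lemma frequently_nhdsGT_of_ae {p : ℝ → Prop} (h : ∀ᵐ x, p x) (t : ℝ) : ∃ᶠ x in 𝓝[>] t, p x := by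
  intro hnot
  obtain ⟨a, hta, hsub⟩ := mem_nhdsGT_iff_exists_Ioo_subset.1 hnot
  obtain ⟨x, hpx, hx⟩ := (Measure.dense_of_ae h).exists_between hta
  exact hsub hx hpx

lemma le_of_ae_le_of_monotone {f l : ℝ → ℝ} {a t : ℝ} (hf : Monotone f) (hat : a < t)
    (hl : ContinuousAt l t) (h : ∀ᵐ x ∂volume.restrict (Ioi a), l x ≤ f x) : l t ≤ f t := by
  have hfreq := frequently_nhdsLT_of_ae ((ae_restrict_iff' measurableSet_Ioi).1 h) t
  have hnear : ∀ᶠ x in 𝓝[<] t, x ∈ Ioo a t := Ioo_mem_nhdsLT hat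
  refine le_of_tendsto_of_frequently (hl.mono_left nhdsWithin_le_nhds)
    ((hfreq.and_eventually hnear).mono fun x hx => ?_)
  exact (hx.1 hx.2.1).trans (hf hx.2.2.le)

lemma le_of_ae_ge_of_monotone {f u : ℝ → ℝ} {a t : ℝ} (hf : Monotone f) (hat : a < t)
    (hu : ContinuousAt u t) (h : ∀ᵐ x ∂volume.restrict (Ioi a), f x ≤ u x) : f t ≤ u t := by
  have hfreq := frequently_nhdsGT_of_ae ((ae_restrict_iff' measurableSet_Ioi).1 h) t
  refine ge_of_tendsto_of_frequently (hu.mono_left nhdsWithin_le_nhds)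
    ((hfreq.and_eventually self_mem_nhdsWithin).mono fun x hx => ?_)
  exact (hf (le_of_lt hx.2)).trans (hx.1 (hat.trans hx.2))

/-- A law on `[0, ∞)` whose Laplace transform at `θ²/2` is `√(θ / sinh θ)`. This is the law of the
squared norm of a centered Gaussian process with the covariance `neumannKernel`. -/
structure IsSinhLaw (μ : Measure ℝ) : Prop where
  isProbabilityMeasure : IsProbabilityMeasure μ
  ae_nonneg : ∀ᵐ x ∂μ, 0 ≤ x
  mgf_eq : ∀ θ : ℝ, 0 < θ → mgf id μ (-(θ ^ 2 / 2)) = √(θ / Real.sinh θ)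

namespace IsSinhLaw

variable {μ ν : Measure ℝ}

lemma mgf_neg (hμ : IsSinhLaw μ) {s : ℝ} (hs : 0 < s) :
    mgf id μ (-s) = √(√(2 * s) / Real.sinh √(2 * s)) := by
  rw [← hμ.mgf_eq _ (Real.sqrt_pos.2 (by positivity)), Real.sq_sqrt (by positivity),
    mul_div_cancel_left₀ s two_ne_zero]

lemma unique (hμ : IsSinhLaw μ) (hν : IsSinhLaw ν) : μ = ν := by
  have := hμ.isProbabilityMeasure
  have := hν.isProbabilityMeasure
  refine measure_ext_of_mgf_neg_natCast hμ.ae_nonneg hν.ae_nonneg fun n => ?_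
  rcases n.eq_zero_or_pos with rfl | hn
  · simp
  · have hn' : (0 : ℝ) < n := Nat.cast_pos.2 hn
    rw [hμ.mgf_neg hn', hν.mgf_neg hn']

lemma laplaceTransform_cdf_eq (hμ : IsSinhLaw μ) {s : ℝ} (hs : 0 < s) :
    laplaceTransform (fun t => μ (Iic t)) s = laplaceTransform sinhCdf s := by
  have := hμ.isProbabilityMeasure
  have hθ := laplaceTransform_sinhCdf (Real.sqrt_pos.2 (by positivity : 0 < 2 * s))
  rw [Real.sq_sqrt (by positivity), mul_div_cancel_left₀ s two_ne_zero] at hθ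
  rw [laplaceTransform_cdf hμ.ae_nonneg hs, hμ.mgf_neg hs, hθ]

lemma ae_cdf_eq_sinhCdf (hμ : IsSinhLaw μ) :
    (fun t => μ (Iic t)) =ᵐ[volume.restrict (Ioi (0 : ℝ))] sinhCdf := by
  have := hμ.isProbabilityMeasure
  have hmono : Monotone fun t => μ (Iic t) := fun a b hab => measure_mono (Iic_subset_Iic.2 hab)
  refine ae_eq_of_laplaceTransform_natCast_succ_eq hmono.measurable measurable_sinhCdf ?_
    fun n => hμ.laplaceTransform_cdf_eq (by positivity)
  rw [laplaceTransform_cdf hμ.ae_nonneg one_pos]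
  exact ENNReal.ofReal_ne_top

lemma monotone_cdf (hμ : IsSinhLaw μ) : Monotone fun t => μ.real (Iic t) := fun a b hab => by
  have := hμ.isProbabilityMeasure
  exact measureReal_mono (Iic_subset_Iic.2 hab)

lemma le_cdf (hμ : IsSinhLaw μ) {t : ℝ} (ht : 0 < t) :
    √(8 / Real.pi) * Real.exp (-(1 / (8 * t))) * (1 - 3 / 2 * t) ≤ μ.real (Iic t) := by
  have := hμ.isProbabilityMeasure
  have : 8 * t ≠ 0 := by positivity
  refine le_of_ae_le_of_monotone
    (l := fun t => √(8 / Real.pi) * Real.exp (-(1 / (8 * t))) * (1 - 3 / 2 * t))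
    hμ.monotone_cdf ht (by fun_prop (disch := assumption)) ?_
  filter_upwards [hμ.ae_cdf_eq_sinhCdf, ae_restrict_mem measurableSet_Ioi] with x hx hx0
  exact (ENNReal.ofReal_le_iff_le_toReal (measure_ne_top μ _)).1 ((le_sinhCdf hx0).trans_eq hx.symm)

lemma cdf_le (hμ : IsSinhLaw μ) {t : ℝ} (ht : 0 < t) :
    μ.real (Iic t) ≤
      √(8 / Real.pi) * Real.exp (-(1 / (8 * t))) * (√(1 - Real.exp (-(1 / t))))⁻¹ := by
  have : t ≠ 0 := ht.ne'
  have : 8 * t ≠ 0 := by positivity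
  have : √(1 - Real.exp (-(1 / t))) ≠ 0 :=
    (Real.sqrt_pos.2 (sub_pos.2 (Real.exp_lt_one_iff.2 (by simp [ht])))).ne'
  refine le_of_ae_ge_of_monotone
    (u := fun t => √(8 / Real.pi) * Real.exp (-(1 / (8 * t))) * (√(1 - Real.exp (-(1 / t))))⁻¹)
    hμ.monotone_cdf ht (by fun_prop (disch := assumption)) ?_
  filter_upwards [hμ.ae_cdf_eq_sinhCdf, ae_restrict_mem measurableSet_Ioi] with x hx hx0
  exact ENNReal.toReal_le_of_le_ofReal (by positivity) (hx.trans_le (sinhCdf_le hx0))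

lemma isEquivalent_cdf (hμ : IsSinhLaw μ) :
    (fun t : ℝ => μ.real (Iic t)) ~[𝓝[>] 0]
      (fun t : ℝ => √(8 / Real.pi) * Real.exp (-(1 / (8 * t)))) := by
  have hpos (t : ℝ) : 0 < √(8 / Real.pi) * Real.exp (-(1 / (8 * t))) := by
    have := Real.pi_pos
    positivity
  rw [Asymptotics.isEquivalent_iff_tendsto_one (Eventually.of_forall fun t => (hpos t).ne')]
  have hlower : Tendsto (fun t : ℝ => 1 - 3 / 2 * t) (𝓝[>] 0) (𝓝 1) :=
    tendsto_nhdsWithin_of_tendsto_nhds (Continuous.tendsto' (by fun_prop) 0 1 (by simp))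
  have hexp : Tendsto (fun t : ℝ => Real.exp (-(1 / t))) (𝓝[>] 0) (𝓝 0) := by
    simpa only [one_div, Function.comp_def] using
      Real.tendsto_exp_neg_atTop_nhds_zero.comp tendsto_inv_nhdsGT_zero
  have hupper : Tendsto (fun t : ℝ => (√(1 - Real.exp (-(1 / t))))⁻¹) (𝓝[>] 0) (𝓝 1) := by
    simpa using ((hexp.const_sub 1).sqrt).inv₀ (by simp)
  refine tendsto_of_tendsto_of_tendsto_of_le_of_le' hlower hupper ?_ ?_
  · filter_upwards [self_mem_nhdsWithin] with t ht
    rw [Pi.div_apply, le_div_iff₀' (hpos t)]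
    exact hμ.le_cdf ht
  · filter_upwards [self_mem_nhdsWithin] with t ht
    rw [Pi.div_apply, div_le_iff₀' (hpos t)]
    exact hμ.cdf_le ht

end IsSinhLaw

end SmallBallAsymptotics

section JointMeasurability

variable {Ω T : Type*} [MeasurableSpace Ω] [MeasurableSpace T] {P : Measure Ω} {ν : Measure T}
  {X : T → Ω → ℝ}

lemma aemeasurable_uncurry_comp_simpleFunc [SFinite P] (hm : ∀ t, AEMeasurable (X t) P)
    (f : SimpleFunc T T) : AEMeasurable (Function.uncurry fun t => X (f t)) (ν.prod P) := by
  refine ⟨fun p => (hm (f p.1)).mk _ p.2, (f.comp Prod.fst measurable_fst).measurable_bind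
    (fun t p => (hm t).mk _ p.2) fun t => (hm t).measurable_mk.comp measurable_snd, ?_⟩
  have hmk : ∀ᵐ ω ∂P, ∀ t ∈ f.range, X t ω = (hm t).mk _ ω :=
    (Finset.eventually_all _).2 fun t _ => (hm t).ae_eq_mk
  filter_upwards [Measure.quasiMeasurePreserving_snd.ae hmk] with p hp
  exact hp _ (f.mem_range_self _)

lemma aemeasurable_uncurry_of_ae_continuous [SFinite P] [TopologicalSpace T]
    [TopologicalSpace.PseudoMetrizableSpace T] [SecondCountableTopology T]
    [OpensMeasurableSpace T] (hm : ∀ t, AEMeasurable (X t) P)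
    (hc : ∀ᵐ ω ∂P, Continuous (X · ω)) : AEMeasurable (Function.uncurry X) (ν.prod P) := by
  have hid : StronglyMeasurable (id : T → T) := stronglyMeasurable_id
  refine aemeasurable_of_tendsto_metrizable_ae atTop
    (fun n => aemeasurable_uncurry_comp_simpleFunc hm (hid.approx n)) ?_
  filter_upwards [Measure.quasiMeasurePreserving_snd.ae hc] with p hp
  exact (hp.tendsto p.1).comp (hid.tendsto_approx p.1)

end JointMeasurability

section BrownianMotion

variable {Ω : Type*} [MeasurableSpace Ω] {P : Measure Ω} {W : NNReal → Ω → ℝ}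

lemma isCenteredGaussianOnUnit_onUnit (hW : IsBrownianReal W P) :
    IsCenteredGaussianOnUnit (onUnit W) P where
  gaussian := hW.isGaussianProcess.comp_right fun t : Icc (0 : ℝ) 1 => (t : ℝ).toNNReal
  mean_zero _ _ := hW.integral_eval _
  aemeasurable := by
    have := hW.isGaussianProcess.isProbabilityMeasure
    exact aemeasurable_uncurry_of_ae_continuous (fun _ => hW.aemeasurable _)
      (hW.cont.mono fun _ hω => hω.comp continuous_real_toNNReal)

lemma covKernel_onUnit (hW : IsBrownianReal W P) {t s : ℝ} (ht : 0 ≤ t) (hs : 0 ≤ s) :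
    covKernel (onUnit W) P t s = min t s := by
  have := hW.isGaussianProcess.isProbabilityMeasure
  have hm (r : NNReal) : MemLp (W r) 2 P := (hW.isGaussianProcess.hasGaussianLaw_eval r).memLp_two
  have h := hW.covariance_eval t.toNNReal s.toNNReal
  rw [covariance_eq_sub (hm _) (hm _), hW.integral_eval, zero_mul, sub_zero, NNReal.coe_min,
    Real.coe_toNNReal _ ht, Real.coe_toNNReal _ hs] at h
  exact h

end BrownianMotion

namespace IsCenteredGaussianOnUnit

variable {Ω Ω' : Type*} [MeasurableSpace Ω] [MeasurableSpace Ω'] {P : Measure Ω} {P' : Measure Ω'}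
  [IsProbabilityMeasure P] [IsProbabilityMeasure P'] {Y : ℝ → Ω → ℝ} {Y' : ℝ → Ω' → ℝ}

lemma memLp_uncurry_of_neumannKernel (hY : IsCenteredGaussianOnUnit Y P)
    (hK : ∀ t ∈ Icc (0 : ℝ) 1, ∀ s ∈ Icc (0 : ℝ) 1, covKernel Y P t s = neumannKernel t s) :
    MemLp (Function.uncurry Y) 2 (unitVolume.prod P) :=
  hY.memLp_uncurry (continuous_neumannKernel.continuousOn.congr fun p hp => hK p.1 hp.1 p.2 hp.2)

lemma aemeasurable_sqNorm_of_neumannKernel (hY : IsCenteredGaussianOnUnit Y P)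
    (hK : ∀ t ∈ Icc (0 : ℝ) 1, ∀ s ∈ Icc (0 : ℝ) 1, covKernel Y P t s = neumannKernel t s) :
    AEMeasurable (sqNorm Y) P :=
  (integrable_sqNorm (hY.memLp_uncurry_of_neumannKernel hK)).aemeasurable

lemma isSinhLaw_map_sqNorm (hY : IsCenteredGaussianOnUnit Y P)
    (hK : ∀ t ∈ Icc (0 : ℝ) 1, ∀ s ∈ Icc (0 : ℝ) 1, covKernel Y P t s = neumannKernel t s) :
    IsSinhLaw (P.map (sqNorm Y)) where
  isProbabilityMeasure :=
    Measure.isProbabilityMeasure_map (hY.aemeasurable_sqNorm_of_neumannKernel hK)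
  ae_nonneg := (ae_map_iff (hY.aemeasurable_sqNorm_of_neumannKernel hK) measurableSet_Ici).2
    (ae_of_all _ fun ω => sqNorm_nonneg Y ω)
  mgf_eq θ hθ := by
    rw [mgf_id_map (hY.aemeasurable_sqNorm_of_neumannKernel hK)]
    exact hY.mgf_sqNorm_of_neumannKernel (hY.memLp_uncurry_of_neumannKernel hK) hK hθ

lemma identDistrib_pathNorm_of_neumannKernel (hY : IsCenteredGaussianOnUnit Y P)
    (hK : ∀ t ∈ Icc (0 : ℝ) 1, ∀ s ∈ Icc (0 : ℝ) 1, covKernel Y P t s = neumannKernel t s)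
    (hY' : IsCenteredGaussianOnUnit Y' P')
    (hK' : ∀ t ∈ Icc (0 : ℝ) 1, ∀ s ∈ Icc (0 : ℝ) 1, covKernel Y' P' t s = neumannKernel t s) :
    IdentDistrib (pathNorm Y) (pathNorm Y') P P' :=
  have hsq : IdentDistrib (sqNorm Y) (sqNorm Y') P P' :=
    { aemeasurable_fst := hY.aemeasurable_sqNorm_of_neumannKernel hK
      aemeasurable_snd := hY'.aemeasurable_sqNorm_of_neumannKernel hK'
      map_eq := (hY.isSinhLaw_map_sqNorm hK).unique (hY'.isSinhLaw_map_sqNorm hK') }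
  hsq.comp Real.continuous_sqrt.measurable

lemma measureReal_pathNorm_le_of_neumannKernel (hY : IsCenteredGaussianOnUnit Y P)
    (hK : ∀ t ∈ Icc (0 : ℝ) 1, ∀ s ∈ Icc (0 : ℝ) 1, covKernel Y P t s = neumannKernel t s)
    {ε : ℝ} (hε : 0 ≤ ε) :
    P.real {ω | pathNorm Y ω ≤ ε} = (P.map (sqNorm Y)).real (Iic (ε ^ 2)) := by
  rw [map_measureReal_apply_of_aemeasurable (hY.aemeasurable_sqNorm_of_neumannKernel hK)
    measurableSet_Iic]
  congr 1
  ext ω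
  exact Real.sqrt_le_left hε

lemma isEquivalent_measureReal_pathNorm_le (hY : IsCenteredGaussianOnUnit Y P)
    (hK : ∀ t ∈ Icc (0 : ℝ) 1, ∀ s ∈ Icc (0 : ℝ) 1, covKernel Y P t s = neumannKernel t s) :
    (fun ε : ℝ => P.real {ω | pathNorm Y ω ≤ ε}) ~[𝓝[>] 0]
      (fun ε : ℝ => (8 / Real.pi) ^ (1 / 2 : ℝ) * Real.exp (-(1 / 8) * ε ^ (-2 : ℤ))) := by
  have hsq : Tendsto (fun ε : ℝ => ε ^ 2) (𝓝[>] 0) (𝓝[>] 0) :=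
    tendsto_nhdsWithin_iff.2 ⟨tendsto_nhdsWithin_of_tendsto_nhds
      (Continuous.tendsto' (by fun_prop) 0 0 (zero_pow two_ne_zero)),
      eventually_mem_nhdsWithin.mono fun _ hε => pow_pos (mem_Ioi.1 hε) 2⟩
  have hcdf := (hY.isSinhLaw_map_sqNorm hK).isEquivalent_cdf.comp_tendsto hsq
  refine (hcdf.congr_left ?_).congr_right (Eventually.of_forall fun ε => ?_)
  · filter_upwards [self_mem_nhdsWithin] with ε hε
    exact (hY.measureReal_pathNorm_le_of_neumannKernel hK (le_of_lt hε)).symm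
  · have hexp : -(1 / (8 * ε ^ 2)) = -(1 / 8) * ε ^ (-2 : ℤ) := by
      rw [zpow_neg, zpow_ofNat]
      ring
    rw [Function.comp_apply, Real.sqrt_eq_rpow, hexp]

end IsCenteredGaussianOnUnit

theorem mainTheorem2 (α : ℝ) (hα : α ≠ -1)
    {Ω : Type*} [MeasurableSpace Ω] (P : Measure Ω) [IsProbabilityMeasure P]
    (X : ℝ → Ω → ℝ) (hX : IsCenteredGaussianOnUnit X P)
    (hG : IsGreenFunction (twistedConditions α) (covKernel X P)) :
    -- almost every sample path is square integrable, so the objects below are well defined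
    (∀ᵐ ω ∂P, MemLp (fun t => X t ω) 2 (volume.restrict (Icc (0 : ℝ) 1))) ∧
    -- the demeaned process is the Green Gaussian process of the Neumann problem
    IsCenteredGaussianOnUnit (demean X) P ∧
    IsGeneralizedGreenFunction neumannConditions (covKernel (demean X) P) ∧
    -- equality in law with the norm of the demeaned Wiener process
    (∀ {Ω' : Type*} [MeasurableSpace Ω'] (P' : Measure Ω') [IsProbabilityMeasure P']
      (W : NNReal → Ω' → ℝ), IsBrownianReal W P' →
      IdentDistrib (pathNorm (demean X)) (pathNorm (demean (onUnit W))) P P' ∧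
      ∀ ε : ℝ, P.real {ω | pathNorm (demean X) ω ≤ ε} =
        P'.real {ω | pathNorm (demean (onUnit W)) ω ≤ ε}) ∧
    -- small ball asymptotics
    (fun ε : ℝ => P.real {ω | pathNorm (demean X) ω ≤ ε}) ~[𝓝[>] 0]
      (fun ε : ℝ => (8 / Real.pi) ^ (1 / 2 : ℝ) * Real.exp (-(1 / 8) * ε ^ (-2 : ℤ))) := by
  have h2 := hX.memLp_uncurry hG.continuousOn
  have hY := hX.demean h2
  have hK (t : ℝ) (ht : t ∈ Icc (0 : ℝ) 1) (s : ℝ) (hs : s ∈ Icc (0 : ℝ) 1) :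
      covKernel (demean X) P t s = neumannKernel t s := by
    rw [hX.covKernel_demean h2 ht hs, doublyCentered_congr
      (fun _ hx _ hy => hG.eq_twistedKernel hα hx hy) ht hs, doublyCentered_twistedKernel α ht hs]
  refine ⟨ae_memLp_two_path h2, hY, isGeneralizedGreenFunction_neumann_of_eq hK,
    fun P' _ W hW => ?_, hY.isEquivalent_measureReal_pathNorm_le hK⟩
  have hB := isCenteredGaussianOnUnit_onUnit hW
  have hmin (t : ℝ) (ht : t ∈ Icc (0 : ℝ) 1) (s : ℝ) (hs : s ∈ Icc (0 : ℝ) 1) :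
      covKernel (onUnit W) P' t s = min t s := covKernel_onUnit hW ht.1 hs.1
  have hB2 := hB.memLp_uncurry ((by fun_prop : ContinuousOn (fun p : ℝ × ℝ => min p.1 p.2)
    (Icc 0 1 ×ˢ Icc 0 1)).congr fun p hp => hmin p.1 hp.1 p.2 hp.2)
  have hBK (t : ℝ) (ht : t ∈ Icc (0 : ℝ) 1) (s : ℝ) (hs : s ∈ Icc (0 : ℝ) 1) :
      covKernel (demean (onUnit W)) P' t s = neumannKernel t s := by
    rw [hB.covKernel_demean hB2 ht hs, doublyCentered_congr hmin ht hs, doublyCentered_min ht hs]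
  have hid := hY.identDistrib_pathNorm_of_neumannKernel hK (hB.demean hB2) hBK
  exact ⟨hid, fun ε => congrArg ENNReal.toReal (hid.measure_mem_eq measurableSet_Iic)⟩
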